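/- **Setting.** Let $(\Omega,\Upsilon,P)$ be a probability space, $(X_{i,n})_{1\le i\le n,\,n\ge1}$ an array of random variables with values in a measurable space $\mathcal X$, $\mathcal F\ne\emptyset$ a class of measurable functions $\mathcal X\to\mathbb R$ with a finite measurable envelope $F$ (that is, $|f|\le F$ for all $f\in\mathcal F$) such that $\mathrm E\,F(X_{i,n})<\infty$ for all $1\le i\le n$, $\rho$ a semimetric on $\mathcal F$ (distinct elements may have distance $0$), and $\mathcal A\ne\emptyset$ a family of Borel sets $A\subset[0,1]$ with $\lambda(\partial A)=0$, where $\lambda$ is Lebesgue measure. For $n\ge1$ and $(A,f)\in\mathcal A\times\mathcal F$ let $$\mathbb Z_n^s(A,f)=\frac1{\sqrt n}\sum_{i=1}^n\lambda\big((i-1,i]\cap nA\big)\big(f(X_{i,n})-\mathrm E f(X_{i,n})\big),$$ and put $\tau_s((A,f),(B,g))=\sqrt{\lambda(A\triangle B)}+\rho(f,g)$ and $\tau((A,f),(B,g))=\lambda(A\triangle B)+\rho(f,g)$. Let $N(\mathcal A\times\mathcal F,\tau_s,\varepsilon)\in\mathbb N\cup\{\infty\}$ be the least number of open $\tau_s$-balls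 of radius $\varepsilon$ with centers in $\mathcal A\times\mathcal F$ that cover $\mathcal A\times\mathcal F$, and let $\Delta_s\in[0,\infty]$ be the $\tau_s$-diameter of $\mathcal A\times\mathcal F$. Let $\psi\ne0$ be a nondecreasing convex function on $[0,\infty)$ with $\psi(0)=0$ and $\limsup_{x,y\to\infty}\psi(x)\psi(y)/\psi(cxy)<\infty$ for some constant $c>0$, let $\psi^{-1}$ be its inverse (with $\psi^{-1}(\infty)=\infty$), let $\|Y\|_{L_\psi}=\inf\{C>0:\mathrm E\,\psi(|Y|/C)\le1\}$, and assume $\|Y\|_{L_1}\le\|Y\|_{L_\psi}$ for all real random variables $Y$ on $(\Omega,\Upsilon,P)$. Assume that, for each $n$, $\mathbb Z_n^s$ is separable, in the sense that there is a countable $S_n\subset\mathcal A\times\mathcal F$ such that for every $\eta>0$, almost surely, $\sup_{\tau_s((A,f),(B,g))<\eta}|\mathbb Z_n^s(A,f)-\mathbb Z_n^s(B,g)|$ does not change if $(A,f)$ and $(B,g)$ range over $S_n$ only. Assume further that there are constants $C_1,C_2$ such that for all $n\ge1$, $A,B\in\mathcal A$ and $f,g\in\mathcal F$: (i) $\sup_{h\in\mathcal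 F}\|\mathbb Z_n^s(A,h)-\mathbb Z_n^s(B,h)\|_{L_\psi}\le C_1\sqrt{\lambda(A\triangle B)}$; (ii) $\sup_{D\in\mathcal A}\|\mathbb Z_n^s(D,f)-\mathbb Z_n^s(D,g)\|_{L_\psi}\le C_2\,\rho(f,g)$. **Theorem.** (1) Suppose in addition that (iii) $\displaystyle\int_0^{\Delta_s}\psi^{-1}\big(N(\mathcal A\times\mathcal F,\tau_s,\varepsilon/2)\big)\,d\varepsilon<\infty.$ Then: - For every $\varepsilon>0$ there is $\eta>0$ such that for all $n\ge1$ the supremum below is measurable up to a null set and $$\mathrm E\Big\{\sup_{\tau_s((A,f),(B,g))<\eta}|\mathbb Z_n^s(A,f)-\mathbb Z_n^s(B,g)|\Big\}<\varepsilon .$$ - (AEC) holds for both $d=\tau_s$ and $d=\tau$: for every $\varepsilon>0$, with $P^*$ the outer probability, $$\lim_{\delta\downarrow0}\limsup_{n\to\infty}P^*\Big(\sup_{d((A,f),(B,g))\le\delta}|\mathbb Z_n^s(A,f)-\mathbb Z_n^s(B,g)|>\varepsilon\Big)=0 .$$ - If all finite-dimensional distributions of $\mathbb Z_n^s$ converge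 weakly as $n\to\infty$, then there is a tight Borel probability measure $\mu$ on $\ell^\infty(\mathcal A\times\mathcal F)$ (bounded real functions with the supremum norm) whose finite-dimensional marginals are the limits, and $\mathbb Z_n^s$ converges weakly to $\mu$, that is, $\mathrm E^*h(\mathbb Z_n^s)\to\int h\,d\mu$ for every bounded continuous $h:\ell^\infty(\mathcal A\times\mathcal F)\to\mathbb R$, where $\mathrm E^*$ is the outer expectation. (2) If $N(\mathcal A\times\mathcal F,\tau_s,\varepsilon)=O(\varepsilon^{-a})$ as $\varepsilon\downarrow0$ for some $a>0$, and $\psi(x)=x^p$ with $p>\max(a,1)$, then (iii) holds, and for each $n\ge1$ there is a version $\tilde{\mathbb Z}_n^s$ of $\mathbb Z_n^s$ (that is, $\tilde{\mathbb Z}_n^s(A,f)=\mathbb Z_n^s(A,f)$ almost surely for each $(A,f)$) with $\tau_s$-continuous paths, almost all of which are bounded and uniformly $\tau_s$-continuous on $\mathcal A\times\mathcal F$. -/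

import Mathlib

open MeasureTheory Filter Topology
open scoped ENNReal BoundedContinuousFunction

noncomputable section

namespace SmoothedEmpirical

/-! Semimetrics, diameters and covering numbers -/

/-- A (finite) semimetric: a metric, except that distinct points may have distance zero. -/
structure IsSemimetric {T : Type*} (d : T → T → ℝ) : Prop where
  self : ∀ s, d s s = 0
  nonneg : ∀ s t, 0 ≤ d s t
  symm : ∀ s t, d s t = d t s
  triangle : ∀ r s t, d r t ≤ d r s + d s t

/-- The diameter of the index set for `d`, possibly infinite. -/
def diameter {T : Type*} (d : T → T → ℝ) : ℝ≥0∞ := ⨆ s, ⨆ t, ENNReal.ofReal (d s t)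

/-- The covering number: the least number of open `d`-balls of radius `ε`, with centers in the
index set, that cover the index set (`⊤` if no finite number suffices). -/
def coveringNumber {T : Type*} (d : T → T → ℝ) (ε : ℝ) : ℕ∞ :=
  ⨅ (S : Finset T) (_ : ∀ t, ∃ s ∈ S, d s t < ε), (S.card : ℕ∞)

/-- `N(T, d, ε) = O(ε ^ (-a))` as `ε ↓ 0`. -/
def IsPolynomialClass {T : Type*} (d : T → T → ℝ) (a : ℝ) : Prop :=
  ∃ K : ℝ, ∀ᶠ ε in 𝓝[>] (0 : ℝ), (coveringNumber d ε : ℝ≥0∞) ≤ ENNReal.ofReal (K * ε ^ (-a))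

/-! Young functions and Orlicz norms; only the values of `ψ` on `[0, ∞)` matter. -/

/-- A nondecreasing Young function: nonzero, convex and nondecreasing on `[0, ∞)`, zero at `0`. -/
structure IsYoung (ψ : ℝ → ℝ) : Prop where
  convex : ConvexOn ℝ (Set.Ici 0) ψ
  monotone : MonotoneOn ψ (Set.Ici 0)
  zero : ψ 0 = 0
  ne_zero : ∃ x, 0 ≤ x ∧ ψ x ≠ 0

/-- `limsup_{x, y → ∞} ψ x * ψ y / ψ (c * x * y) < ∞` for some constant `c > 0`. -/
def LimsupCondition (ψ : ℝ → ℝ) : Prop :=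
  ∃ c : ℝ, 0 < c ∧
    limsup (fun q : ℝ × ℝ => ENNReal.ofReal (ψ q.1 * ψ q.2 / ψ (c * q.1 * q.2)))
      (atTop ×ˢ atTop) < ⊤

/-- The inverse of a Young function, with `ψ⁻¹ ∞ = ∞`. For a nondecreasing Young function and
`0 < y < ∞` this is the unique `x ≥ 0` with `ψ x = y`. -/
def youngInv (ψ : ℝ → ℝ) (y : ℝ≥0∞) : ℝ≥0∞ :=
  ⨆ (x : ℝ) (_ : 0 ≤ x ∧ ENNReal.ofReal (ψ x) ≤ y), ENNReal.ofReal x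

/-- The Orlicz (Luxemburg) norm `inf {C > 0 | E ψ(|Y| / C) ≤ 1}`, possibly infinite. -/
def orliczNorm {Ω : Type*} [MeasurableSpace Ω] (P : Measure Ω) (ψ : ℝ → ℝ) (Y : Ω → ℝ) : ℝ≥0∞ :=
  ⨅ (C : ℝ) (_ : 0 < C ∧ ∫⁻ ω, ENNReal.ofReal (ψ (|Y ω| / C)) ∂P ≤ 1), ENNReal.ofReal C

/-- The entropy integral `∫_0^Δ ψ⁻¹(N(T, d, ε / 2)) dε`, where `Δ` is the diameter. -/
def entropyIntegral {T : Type*} (ψ : ℝ → ℝ) (d : T → T → ℝ) : ℝ≥0∞ :=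
  ∫⁻ ε in {ε : ℝ | 0 < ε ∧ ENNReal.ofReal ε ≤ diameter d},
    youngInv ψ (coveringNumber d (ε / 2) : ℝ≥0∞)

/-! Stochastic processes `Z : T → Ω → ℝ` -/

/-- `sup |Z s - Z t|` over all `s, t ∈ S` with `d s t < η`. -/
def modulus {T Ω : Type*} (Z : T → Ω → ℝ) (d : T → T → ℝ) (S : Set T) (η : ℝ) (ω : Ω) : ℝ≥0∞ :=
  ⨆ (s : T) (t : T) (_ : s ∈ S ∧ t ∈ S ∧ d s t < η), ENNReal.ofReal |Z s ω - Z t ω|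

/-- Separability: the supremal increments stay almost surely the same if the index set is replaced
by a suitable countable subset. -/
def IsSeparableProcess {T Ω : Type*} [MeasurableSpace Ω] (P : Measure Ω) (Z : T → Ω → ℝ)
    (d : T → T → ℝ) : Prop :=
  ∃ S : Set T, S.Countable ∧
    ∀ η : ℝ, 0 < η → ∀ᵐ ω ∂P, modulus Z d Set.univ η ω = modulus Z d S η ω

/-- Asymptotic uniform equicontinuity in (outer) probability with respect to `d`. The value of a
measure on an arbitrary set is the outer measure of that set. -/
def AsympEquicontinuous {T Ω : Type*} [MeasurableSpace Ω] (P : Measure Ω) (Z : ℕ → T → Ω → ℝ)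
    (d : T → T → ℝ) : Prop :=
  ∀ ε : ℝ, 0 < ε →
    Tendsto
      (fun δ : ℝ => limsup (fun n : ℕ => P {ω | ENNReal.ofReal ε <
        ⨆ (s : T) (t : T) (_ : d s t ≤ δ), ENNReal.ofReal |Z n s ω - Z n t ω|}) atTop)
      (𝓝[>] 0) (𝓝 0)

/-- The finite-dimensional distributions of `Z n` converge weakly, the limit law of the marginal
indexed by the finite set `I` being `ν I`. -/
def FidiConverges {T Ω : Type*} [MeasurableSpace Ω] (P : Measure Ω) (Z : ℕ → T → Ω → ℝ)
    (ν : (I : Finset T) → Measure (I → ℝ)) : Prop :=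
  ∀ (I : Finset T) (h : (I → ℝ) →ᵇ ℝ),
    Tendsto (fun n : ℕ => ∫ ω, h (fun t => Z n t ω) ∂P) atTop (𝓝 (∫ x, h x ∂(ν I)))

/-- The path `z` is continuous for the semimetric `d`. -/
def ContinuousPath {T : Type*} (d : T → T → ℝ) (z : T → ℝ) : Prop :=
  ∀ s, ∀ ε : ℝ, 0 < ε → ∃ δ : ℝ, 0 < δ ∧ ∀ t, d s t < δ → |z s - z t| < ε

/-- The path `z` is bounded and uniformly continuous for the semimetric `d`. -/
def BoundedUniformlyContinuousPath {T : Type*} (d : T → T → ℝ) (z : T → ℝ) : Prop :=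
  (∃ M : ℝ, ∀ t, |z t| ≤ M) ∧
    ∀ ε : ℝ, 0 < ε → ∃ δ : ℝ, 0 < δ ∧ ∀ s t, d s t < δ → |z s - z t| < ε

/-! Outer expectations and weak convergence in `ℓ^∞(T)` -/

/-- The outer expectation: the infimum of `E U` over all extended real valued measurable `U ≥ Y`
whose expectation `E U = E U⁺ - E U⁻` exists, i.e. is not of the form `∞ - ∞`. -/
def outerExpectation {Ω : Type*} [MeasurableSpace Ω] (P : Measure Ω) (Y : Ω → ℝ) : EReal :=
  ⨅ (U : Ω → EReal) (_ : Measurable U ∧ (∀ ω, (Y ω : EReal) ≤ U ω) ∧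
      (∫⁻ ω, (U ω).toENNReal ∂P ≠ ⊤ ∨ ∫⁻ ω, (-U ω).toENNReal ∂P ≠ ⊤)),
    ((∫⁻ ω, (U ω).toENNReal ∂P : ℝ≥0∞) : EReal) - ((∫⁻ ω, (-U ω).toENNReal ∂P : ℝ≥0∞) : EReal)

/-- The space of bounded real functions on `T` with the supremum norm. -/
abbrev EllInfty (T : Type*) : Type _ := lp (fun _ : T => ℝ) ∞

instance instMeasurableSpaceEllInfty (T : Type*) : MeasurableSpace (EllInfty T) :=
  borel (EllInfty T)

instance instBorelSpaceEllInfty (T : Type*) : BorelSpace (EllInfty T) := ⟨rfl⟩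

open Classical in
/-- A bounded function as an element of `ℓ^∞(T)` (and `0` for an unbounded function). -/
def toEllInfty {T : Type*} (z : T → ℝ) : EllInfty T :=
  if h : Memℓp z ∞ then ⟨z, h⟩ else 0

/-- Weak convergence (in the sense of Hoffmann-Jørgensen) of arbitrary maps `Y n : Ω → E` to the
Borel law `μ`. -/
def WeaklyConverges {Ω E : Type*} [MeasurableSpace Ω] [TopologicalSpace E] [MeasurableSpace E]
    (P : Measure Ω) (Y : ℕ → Ω → E) (μ : Measure E) : Prop :=
  ∀ h : E →ᵇ ℝ, Tendsto (fun n : ℕ => outerExpectation P (fun ω => h (Y n ω))) atTop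
    (𝓝 ((∫ y, h y ∂μ : ℝ) : EReal))

/-- Tightness of a Borel law. -/
def IsTightLaw {E : Type*} [TopologicalSpace E] [MeasurableSpace E] (μ : Measure E) : Prop :=
  ∀ ε : ℝ≥0∞, 0 < ε → ∃ K : Set E, IsCompact K ∧ μ Kᶜ ≤ ε

/-! The smoothed sequential empirical process -/

/-- Borel subsets of `[0, 1]` whose boundary is a Lebesgue null set. -/
def IsRegularBorel (A : Set ℝ) : Prop :=
  A ⊆ Set.Icc 0 1 ∧ MeasurableSet A ∧ volume (frontier A) = 0

/-- `F` is a finite measurable envelope of the class `𝓕`, integrable along the array. -/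
def IsEnvelope {Ω 𝒳 : Type*} [MeasurableSpace Ω] [MeasurableSpace 𝒳] (P : Measure Ω)
    (X : ℕ → ℕ → Ω → 𝒳) (𝓕 : Set (𝒳 → ℝ)) (F : 𝒳 → ℝ) : Prop :=
  Measurable F ∧ (∀ f ∈ 𝓕, ∀ x, |f x| ≤ F x) ∧
    ∀ n i : ℕ, 1 ≤ i → i ≤ n → Integrable (fun ω => F (X n i ω)) P

/-- The smoothed sequential empirical process
`n^(-1/2) ∑_{i=1}^n λ((i-1, i] ∩ n A) (f (X_{i,n}) - E f (X_{i,n}))`, indexed by `(A, f)`.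
The array variable `X_{i,n}` is written `X n i`. -/
def smoothedProcess {Ω 𝒳 : Type*} [MeasurableSpace Ω] (P : Measure Ω) (X : ℕ → ℕ → Ω → 𝒳)
    (𝓐 : Set (Set ℝ)) (𝓕 : Set (𝒳 → ℝ)) (n : ℕ) (q : 𝓐 × 𝓕) (ω : Ω) : ℝ :=
  (1 / √(n : ℝ)) * ∑ i ∈ Finset.Icc 1 n,
    volume.real (Set.Ioc ((i : ℝ) - 1) (i : ℝ) ∩ (fun x : ℝ => (n : ℝ) * x) '' (q.1 : Set ℝ)) *
      ((q.2 : 𝒳 → ℝ) (X n i ω) - ∫ ω', (q.2 : 𝒳 → ℝ) (X n i ω') ∂P)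

/-- The semimetric `λ(A ∆ B) + ρ(f, g)`. -/
def tau {𝒳 : Type*} (𝓐 : Set (Set ℝ)) (𝓕 : Set (𝒳 → ℝ)) (ρ : 𝓕 → 𝓕 → ℝ) (q r : 𝓐 × 𝓕) : ℝ :=
  volume.real (symmDiff (q.1 : Set ℝ) (r.1 : Set ℝ)) + ρ q.2 r.2

/-- The semimetric `√λ(A ∆ B) + ρ(f, g)`. -/
def tauS {𝒳 : Type*} (𝓐 : Set (Set ℝ)) (𝓕 : Set (𝒳 → ℝ)) (ρ : 𝓕 → 𝓕 → ℝ) (q r : 𝓐 × 𝓕) : ℝ :=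
  √(volume.real (symmDiff (q.1 : Set ℝ) (r.1 : Set ℝ))) + ρ q.2 r.2

/-- If there is an envelope, then all paths of the smoothed process are bounded, so that
`toEllInfty` only repackages them. -/
theorem smoothedProcess_mem {Ω 𝒳 : Type*} [MeasurableSpace Ω] [MeasurableSpace 𝒳] (P : Measure Ω)
    (X : ℕ → ℕ → Ω → 𝒳) (𝓐 : Set (Set ℝ)) (𝓕 : Set (𝒳 → ℝ)) (F : 𝒳 → ℝ)
    (hF : IsEnvelope P X 𝓕 F) (n : ℕ) (ω : Ω) :
    Memℓp (fun q => smoothedProcess P X 𝓐 𝓕 n q ω) ∞ := by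
  refine memℓp_infty ⟨(1 / √(n : ℝ)) * ∑ i ∈ Finset.Icc 1 n,
    1 * (F (X n i ω) + ∫ ω', F (X n i ω') ∂P), ?_⟩
  rintro _ ⟨q, rfl⟩
  simp only [smoothedProcess, norm_mul, Real.norm_eq_abs]
  rw [abs_of_nonneg (by positivity : (0 : ℝ) ≤ 1 / √(n : ℝ))]
  refine mul_le_mul_of_nonneg_left ?_ (by positivity)
  refine (Finset.abs_sum_le_sum_abs _ _).trans (Finset.sum_le_sum fun i hi => ?_)
  rw [Finset.mem_Icc] at hi
  rw [abs_mul, abs_of_nonneg measureReal_nonneg]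
  refine mul_le_mul ?_ ?_ (abs_nonneg _) zero_le_one
  · refine (measureReal_mono Set.inter_subset_left (by simp)).trans ?_
    simp
  · refine (abs_sub _ _).trans (add_le_add (hF.2.1 _ q.2.2 _) ?_)
    rw [← Real.norm_eq_abs]
    exact norm_integral_le_of_norm_le (hF.2.2 n i hi.1 hi.2)
      (Eventually.of_forall fun ω' => hF.2.1 _ q.2.2 (X n i ω'))

end SmoothedEmpirical

end

open SmoothedEmpirical

noncomputable section

namespace SmoothedEmpirical

/-! Young functions -/

/-! Going from (A, f) to (B, g) through (B, f), the two Lipschitz conditions bound the Orlicz norm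
of every increment by K times its τ_s-distance, with K independent of n. Everything else rests on
this bound.

The modulus is controlled by chaining. For m variables of Orlicz norm below κ, the expected maximum
is at most 2κ ψ⁻¹(m) (`IsYoung.lintegral_iSup_le`). Along nets of radius θ/2^j the links therefore
sum to a multiple of the entropy integral over (0, θ], which is small for small θ. What remains is a
fixed finite number of pairs at distance below η, made small by the choice of η
(`exists_lintegral_modulus_le`). Separability passes from countable sets to the whole index set, and
Markov's inequality gives equicontinuity; for τ one uses that small τ forces small τ_s.

For weak convergence, paths are approximated by step functions on finite nets, whose limit laws are
images of the given marginals. Equicontinuity, transferred to these marginals by the portmanteau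
theorem, makes the step laws tight, so Prokhorov's theorem provides a cluster point. It is the weak
limit because, up to small errors, the outer expectation of a Lipschitz function of the process is
its integral under a step law (`AsympEquicontinuous.exists_tight_limit`).

For polynomial classes ψ⁻¹(N) is of order ε^(-a/p), integrable at 0 since a < p. The small expected
modulus makes almost all paths uniformly continuous; the others are replaced by zero. -/

theorem IsYoung.nonneg {ψ : ℝ → ℝ} (hψ : IsYoung ψ) {x : ℝ} (hx : 0 ≤ x) : 0 ≤ ψ x := by
  have := hψ.monotone (Set.mem_Ici.2 le_rfl) (Set.mem_Ici.2 hx) hx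
  rwa [hψ.zero] at this

/-- Convexity together with ψ(0) = 0 makes ψ(x)/x nondecreasing; this is the division-free form. -/
theorem IsYoung.mul_le_mul {ψ : ℝ → ℝ} (hψ : IsYoung ψ) {x y : ℝ} (hx : 0 ≤ x) (hxy : x ≤ y) :
    y * ψ x ≤ x * ψ y := by
  rcases (hx.trans hxy).eq_or_lt with hy | hy
  · have : x = 0 := le_antisymm (hy ▸ hxy) hx
    simp [this, ← hy]
  · have h := hψ.convex.2 (Set.mem_Ici.2 le_rfl) (Set.mem_Ici.2 hy.le)
      (sub_nonneg.2 ((div_le_one hy).2 hxy)) (div_nonneg hx hy.le) (by ring)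
    simp only [hψ.zero, smul_eq_mul, mul_zero, zero_add, div_mul_cancel₀ _ hy.ne'] at h
    calc y * ψ x ≤ y * (x / y * ψ y) := mul_le_mul_of_nonneg_left h hy.le
      _ = x * ψ y := by field_simp

/-- A Young function grows at least linearly beyond any point where it is positive. -/
theorem IsYoung.le_add_mul {ψ : ℝ → ℝ} (hψ : IsYoung ψ) {x y : ℝ} (hx : 0 ≤ x) (hψx : 0 < ψ x)
    (hy : 0 ≤ y) : y ≤ x + x / ψ x * ψ y := by
  rcases le_total y x with h | h
  · have : 0 ≤ x / ψ x * ψ y := mul_nonneg (div_nonneg hx hψx.le) (hψ.nonneg hy)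
    linarith
  · have : y ≤ x / ψ x * ψ y := by
      rw [div_mul_eq_mul_div, le_div_iff₀ hψx]
      exact hψ.mul_le_mul hx h
    linarith

theorem IsYoung.measurable_comp_abs {Ω : Type*} [MeasurableSpace Ω] {ψ : ℝ → ℝ} (hψ : IsYoung ψ)
    {Y : Ω → ℝ} (hY : Measurable Y) {κ : ℝ} (hκ : 0 ≤ κ) :
    Measurable fun ω => ENNReal.ofReal (ψ (|Y ω| / κ)) := by
  -- ψ is monotone only on [0, ∞); truncating the argument at 0 gives a globally monotone, hence
  -- measurable, function.
  have hm : Monotone fun x : ℝ => ψ (max x 0) := fun x y hxy =>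
    hψ.monotone (Set.mem_Ici.2 (le_max_right _ _)) (Set.mem_Ici.2 (le_max_right _ _))
      (max_le_max_right 0 hxy)
  have : (fun ω => ENNReal.ofReal (ψ (|Y ω| / κ)))
      = fun ω => ENNReal.ofReal ((fun x : ℝ => ψ (max x 0)) (|Y ω| / κ)) := by
    funext ω
    simp only [max_eq_left (div_nonneg (abs_nonneg (Y ω)) hκ)]
  rw [this]
  exact (hm.measurable.comp ((measurable_abs.comp hY).div_const κ)).ennreal_ofReal

theorem youngInv_mono (ψ : ℝ → ℝ) : Monotone (youngInv ψ) := fun _ _ h =>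
  iSup_mono fun _ => iSup_mono' fun hx => ⟨⟨hx.1, hx.2.trans h⟩, le_rfl⟩

/-- The maximal inequality needs only this half of the inverse relation, which requires neither
continuity of ψ nor that the supremum in `youngInv` be attained. -/
theorem lt_ofReal_of_youngInv_lt {ψ : ℝ → ℝ} {y : ℝ≥0∞} {x : ℝ}
    (h : youngInv ψ y < ENNReal.ofReal x) : y < ENNReal.ofReal (ψ x) := by
  have hx : 0 < x := by
    by_contra hx
    rw [ENNReal.ofReal_of_nonpos (not_lt.1 hx)] at h
    exact not_lt_zero h
  by_contra hy
  refine h.not_ge ?_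
  exact le_iSup₂_of_le x ⟨hx.le, not_lt.1 hy⟩ le_rfl

theorem IsYoung.exists_lt {ψ : ℝ → ℝ} (hψ : IsYoung ψ) (M : ℝ) : ∃ x, 0 < x ∧ M < ψ x := by
  obtain ⟨x₀, hx₀, h⟩ := hψ.ne_zero
  have hpos : 0 < ψ x₀ := lt_of_le_of_ne (hψ.nonneg hx₀) (Ne.symm h)
  have hx₀' : 0 < x₀ := hx₀.lt_of_ne (by rintro rfl; exact h hψ.zero)
  set c := max 1 (|M| / ψ x₀ + 1) with hc
  refine ⟨c * x₀, by positivity, ?_⟩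
  have h1 : x₀ ≤ c * x₀ := le_mul_of_one_le_left hx₀ (le_max_left _ _)
  have h2 := hψ.mul_le_mul hx₀ h1
  have h3 : c * ψ x₀ ≤ ψ (c * x₀) := by
    refine le_of_mul_le_mul_left ?_ hx₀'
    linarith
  have h4 : (|M| / ψ x₀ + 1) * ψ x₀ ≤ c * ψ x₀ :=
    mul_le_mul_of_nonneg_right (le_max_right _ _) hpos.le
  have h5 : (|M| / ψ x₀ + 1) * ψ x₀ = |M| + ψ x₀ := by field_simp
  linarith [le_abs_self M]

theorem IsYoung.youngInv_lt_top {ψ : ℝ → ℝ} (hψ : IsYoung ψ) {y : ℝ≥0∞} (hy : y < ⊤) :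
    youngInv ψ y < ⊤ := by
  obtain ⟨x, hx, h⟩ := hψ.exists_lt y.toReal
  refine lt_of_le_of_lt (iSup₂_le fun z hz => ENNReal.ofReal_le_ofReal ?_)
    (ENNReal.ofReal_lt_top (r := x))
  by_contra hzx
  have h1 := hψ.monotone (Set.mem_Ici.2 hx.le) (Set.mem_Ici.2 hz.1) (not_le.1 hzx).le
  have h2 := (ENNReal.ofReal_le_iff_le_toReal hy.ne).1 hz.2
  linarith

theorem IsYoung.youngInv_top {ψ : ℝ → ℝ} : youngInv ψ ⊤ = ⊤ := by
  refine ENNReal.eq_top_of_forall_nnreal_le fun r => ?_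
  exact le_iSup₂_of_le (r : ℝ) ⟨r.2, le_top⟩ (by simp)

/-! Orlicz norms and the maximal inequality -/

theorem IsYoung.lintegral_le_one_of_orliczNorm_lt {Ω : Type*} [MeasurableSpace Ω] {P : Measure Ω}
    {ψ : ℝ → ℝ} (hψ : IsYoung ψ) {Y : Ω → ℝ} {κ : ℝ} (h : orliczNorm P ψ Y < ENNReal.ofReal κ) :
    0 < κ ∧ ∫⁻ ω, ENNReal.ofReal (ψ (|Y ω| / κ)) ∂P ≤ 1 := by
  simp only [orliczNorm, iInf_lt_iff] at h
  obtain ⟨C, ⟨hC, hC1⟩, hCκ⟩ := h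
  have hCκ' : C < κ := (ENNReal.ofReal_lt_ofReal_iff_of_nonneg hC.le).1 hCκ
  refine ⟨hC.trans hCκ', (lintegral_mono fun ω => ENNReal.ofReal_le_ofReal ?_).trans hC1⟩
  exact hψ.monotone (Set.mem_Ici.2 (div_nonneg (abs_nonneg _) (hC.trans hCκ').le))
    (Set.mem_Ici.2 (div_nonneg (abs_nonneg _) hC.le))
    (div_le_div_of_nonneg_left (abs_nonneg _) hC hCκ'.le)

/-- Linear growth gives |Y| ≤ κx + κ(x/ψ(x)) ψ(|Y|/κ). In the last term the maximum is replaced by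
the sum, whose expectation is at most the number of variables. Once ψ(x) exceeds that number, the
total is at most 2κx. -/
theorem IsYoung.lintegral_iSup_le {Ω ι : Type*} [MeasurableSpace Ω] {P : Measure Ω}
    [IsProbabilityMeasure P] {ψ : ℝ → ℝ} (hψ : IsYoung ψ) (s : Finset ι) (Y : ι → Ω → ℝ)
    (hY : ∀ i ∈ s, Measurable (Y i)) {κ : ℝ}
    (hκ : ∀ i ∈ s, orliczNorm P ψ (Y i) < ENNReal.ofReal κ) :
    ∫⁻ ω, ⨆ i ∈ s, ENNReal.ofReal |Y i ω| ∂P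
      ≤ 2 * ENNReal.ofReal κ * youngInv ψ (s.card : ℝ≥0∞) := by
  rcases s.eq_empty_or_nonempty with rfl | ⟨i₀, hi₀⟩
  · simp
  have hκ0 : 0 < κ := (hψ.lintegral_le_one_of_orliczNorm_lt (hκ i₀ hi₀)).1
  have key : ∀ x : ℝ, youngInv ψ (s.card : ℝ≥0∞) < ENNReal.ofReal x →
      ∫⁻ ω, ⨆ i ∈ s, ENNReal.ofReal |Y i ω| ∂P ≤ 2 * ENNReal.ofReal κ * ENNReal.ofReal x := by
    intro x hx
    have hx0 : 0 < x := ENNReal.ofReal_pos.1 (bot_le.trans_lt hx)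
    have hcard := lt_ofReal_of_youngInv_lt hx
    have hψx : 0 < ψ x := ENNReal.ofReal_pos.1 (bot_le.trans_lt hcard)
    have hcard' : (s.card : ℝ) ≤ ψ x := by
      have := (ENNReal.lt_ofReal_iff_toReal_lt (by simp)).1 hcard
      simpa using this.le
    have hpt : ∀ ω, ⨆ i ∈ s, ENNReal.ofReal |Y i ω| ≤ ENNReal.ofReal (κ * x)
        + ENNReal.ofReal (κ * (x / ψ x)) * ∑ i ∈ s, ENNReal.ofReal (ψ (|Y i ω| / κ)) := by
      intro ω
      refine iSup₂_le fun i hi => ?_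
      have h1 := hψ.le_add_mul hx0.le hψx (div_nonneg (abs_nonneg (Y i ω)) hκ0.le)
      have h2 : |Y i ω| ≤ κ * x + κ * (x / ψ x) * ψ (|Y i ω| / κ) := by
        calc |Y i ω| = κ * (|Y i ω| / κ) := by field_simp
          _ ≤ κ * (x + x / ψ x * ψ (|Y i ω| / κ)) := mul_le_mul_of_nonneg_left h1 hκ0.le
          _ = _ := by ring
      refine (ENNReal.ofReal_le_ofReal h2).trans (ENNReal.ofReal_add_le.trans ?_)
      rw [ENNReal.ofReal_mul (p := κ * (x / ψ x)) (by positivity)]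
      gcongr
      exact Finset.single_le_sum (f := fun i => ENNReal.ofReal (ψ (|Y i ω| / κ)))
        (fun _ _ => bot_le) hi
    refine (lintegral_mono hpt).trans ?_
    have hm : ∀ i ∈ s, Measurable fun ω => ENNReal.ofReal (ψ (|Y i ω| / κ)) := fun i hi =>
      hψ.measurable_comp_abs (hY i hi) hκ0.le
    rw [lintegral_add_left measurable_const, lintegral_const, measure_univ, mul_one,
      lintegral_const_mul _ (Finset.measurable_sum s hm), lintegral_finsetSum s hm]
    have hsum : ∑ i ∈ s, ∫⁻ ω, ENNReal.ofReal (ψ (|Y i ω| / κ)) ∂P ≤ (s.card : ℝ≥0∞) := by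
      refine (Finset.sum_le_sum fun i hi =>
        (hψ.lintegral_le_one_of_orliczNorm_lt (hκ i hi)).2).trans ?_
      simp
    calc ENNReal.ofReal (κ * x) + ENNReal.ofReal (κ * (x / ψ x))
          * ∑ i ∈ s, ∫⁻ ω, ENNReal.ofReal (ψ (|Y i ω| / κ)) ∂P
        ≤ ENNReal.ofReal (κ * x) + ENNReal.ofReal (κ * (x / ψ x)) * ENNReal.ofReal (ψ x) := by
          gcongr
          exact hsum.trans hcard.le
      _ = 2 * ENNReal.ofReal κ * ENNReal.ofReal x := by
          rw [← ENNReal.ofReal_mul (by positivity), mul_assoc κ, div_mul_cancel₀ _ hψx.ne',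
            ← two_mul, mul_assoc, ← ENNReal.ofReal_mul hκ0.le]
  -- `key` holds for every x above ψ⁻¹(card). If the claim failed, some real x would lie strictly
  -- between ψ⁻¹(card) and the left side divided by 2κ, contradicting `key`.
  by_contra hcon
  rw [not_le, mul_comm, ← ENNReal.lt_div_iff_mul_lt (by left; simp [hκ0])
    (by left; exact ENNReal.mul_ne_top (by simp) (by simp))] at hcon
  obtain ⟨x, -, hx1, hx2⟩ := ENNReal.lt_iff_exists_real_btwn.1 hcon
  rw [ENNReal.lt_div_iff_mul_lt (by left; simp [hκ0])
    (by left; exact ENNReal.mul_ne_top (by simp) (by simp)), mul_comm] at hx2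
  exact hx2.not_ge (key x hx1)

/-! Covering numbers -/

theorem exists_cover_card_le {T : Type*} {d : T → T → ℝ} {ε : ℝ} (h : coveringNumber d ε ≠ ⊤) :
    ∃ S : Finset T, (∀ t, ∃ s ∈ S, d s t < ε) ∧ (S.card : ℕ∞) ≤ coveringNumber d ε := by
  have h1 : coveringNumber d ε < coveringNumber d ε + 1 := by
    rw [ENat.lt_add_one_iff h]
  conv_lhs at h1 => rw [coveringNumber]
  simp only [iInf_lt_iff] at h1
  obtain ⟨S, hS, hS1⟩ := h1
  exact ⟨S, hS, (ENat.lt_add_one_iff h).1 hS1⟩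

theorem coveringNumber_anti {T : Type*} (d : T → T → ℝ) : Antitone (coveringNumber d) :=
  fun _ _ h => iInf_mono fun _ => iInf_mono' fun hS =>
    ⟨fun t => let ⟨s, hs, hst⟩ := hS t; ⟨s, hs, hst.trans_le h⟩, le_rfl⟩

theorem coveringNumber_le_one_of_diameter_eq_zero {T : Type*} [Nonempty T] {d : T → T → ℝ}
    (h : diameter d = 0) {ε : ℝ} (hε : 0 < ε) : coveringNumber d ε ≤ 1 := by
  refine iInf₂_le_of_le {Classical.arbitrary T} (fun t => ⟨_, Finset.mem_singleton_self _, ?_⟩)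
    (by simp)
  have : ENNReal.ofReal (d (Classical.arbitrary T) t) ≤ diameter d := le_iSup₂_of_le _ t le_rfl
  rw [h, nonpos_iff_eq_zero, ENNReal.ofReal_eq_zero] at this
  linarith

/-- A convergent entropy integral is finite near zero, even if the diameter vanishes. -/
theorem exists_entropy_near_zero {T : Type*} [Nonempty T] {d : T → T → ℝ} {ψ : ℝ → ℝ}
    (hψ : IsYoung ψ) (h : entropyIntegral ψ d < ⊤) :
    ∃ r : ℝ, 0 < r ∧
      ∫⁻ ε in Set.Ioc 0 r, youngInv ψ (coveringNumber d (ε / 2) : ℝ≥0∞) < ⊤ := by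
  rcases eq_or_ne (diameter d) 0 with h0 | h0
  -- For zero diameter the entropy integral runs over an empty set and carries no information; but
  -- then one ball suffices at every radius.
  · refine ⟨1, one_pos, lt_of_le_of_lt (setLIntegral_mono' measurableSet_Ioc
      (g := fun _ => youngInv ψ 1) fun ε hε => youngInv_mono ψ ?_) ?_⟩
    · have := coveringNumber_le_one_of_diameter_eq_zero h0 (half_pos hε.1)
      exact_mod_cast this
    · rw [setLIntegral_const]
      exact ENNReal.mul_lt_top (hψ.youngInv_lt_top (by simp)) (by simp)
  · obtain ⟨r, -, hr0, hr⟩ := ENNReal.lt_iff_exists_real_btwn.1 (pos_iff_ne_zero.2 h0)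
    refine ⟨r, ENNReal.ofReal_pos.1 hr0, lt_of_le_of_lt (lintegral_mono_set ?_) h⟩
    exact fun ε hε => ⟨hε.1, (ENNReal.ofReal_le_ofReal hε.2).trans hr.le⟩

theorem coveringNumber_ne_top_of_entropy {T : Type*} [Nonempty T] {d : T → T → ℝ} {ψ : ℝ → ℝ}
    (hψ : IsYoung ψ) (h : entropyIntegral ψ d < ⊤) {ε : ℝ} (hε : 0 < ε) :
    coveringNumber d ε ≠ ⊤ := by
  obtain ⟨r, hr, hint⟩ := exists_entropy_near_zero hψ h
  intro htop
  refine hint.ne (top_le_iff.1 ?_)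
  -- An infinite covering number at ε stays infinite at all smaller radii, so the integrand would be
  -- infinite on (0, q].
  set q := min r (2 * ε) with hq
  have hq0 : 0 < q := lt_min hr (by linarith)
  calc (⊤ : ℝ≥0∞) = ∫⁻ _ in Set.Ioc 0 q, (⊤ : ℝ≥0∞) := by
        rw [setLIntegral_const, Real.volume_Ioc, ENNReal.top_mul (by simpa using hq0)]
    _ ≤ ∫⁻ ε in Set.Ioc 0 q, youngInv ψ (coveringNumber d (ε / 2) : ℝ≥0∞) := by
        refine setLIntegral_mono' measurableSet_Ioc fun x hx => ?_
        have h1 : x / 2 ≤ ε := by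
          have := hx.2.trans (min_le_right _ _)
          linarith
        have h2 : coveringNumber d (x / 2) = ⊤ := top_le_iff.1 (htop ▸ coveringNumber_anti d h1)
        rw [h2, ENat.toENNReal_top, IsYoung.youngInv_top]
    _ ≤ _ := lintegral_mono_set (Set.Ioc_subset_Ioc_right (min_le_left _ _))

/-! Chaining -/

theorem measurable_iSup_abs_sub {T Ω : Type*} [MeasurableSpace Ω] {Z : T → Ω → ℝ}
    (hZ : ∀ t, Measurable (Z t)) (e : T → T) {A : Set T} (hA : A.Countable) :
    Measurable fun ω => ⨆ t ∈ A, ENNReal.ofReal |Z t ω - Z (e t) ω| :=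
  Measurable.biSup A hA fun t _ =>
    (measurable_abs.comp ((hZ t).sub (hZ (e t)))).ennreal_ofReal

theorem ofReal_abs_sub_triangle (a b c : ℝ) :
    ENNReal.ofReal |a - c| ≤ ENNReal.ofReal |a - b| + ENNReal.ofReal |b - c| := by
  rw [← ENNReal.ofReal_add (abs_nonneg _) (abs_nonneg _)]
  exact ENNReal.ofReal_le_ofReal (abs_sub_le a b c)

section Chaining

variable {T Ω : Type*} [MeasurableSpace Ω] {P : Measure Ω} [IsProbabilityMeasure P]
  {ψ : ℝ → ℝ} {d : T → T → ℝ} {K : ℝ} {Z : T → Ω → ℝ}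

/-- One refinement of the chain: each t in B is linked to its ε-close point p t in A and then
follows the old chain `e`. The new links are at most |B| increments of norm below Kε. -/
theorem chain_step (hψ : IsYoung ψ) (hK : 0 < K) (hd : IsSemimetric d)
    (hZ : ∀ t, Measurable (Z t))
    (hZd : ∀ s t, orliczNorm P ψ (fun ω => Z s ω - Z t ω) ≤ ENNReal.ofReal (K * d s t))
    {A B : Finset T} {e p : T → T} {ε : ℝ} (hpA : ∀ t, p t ∈ A) (hpd : ∀ t, d (p t) t < ε) :
    ∫⁻ ω, ⨆ t ∈ B, ENNReal.ofReal |Z t ω - Z (e (p t)) ω| ∂P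
      ≤ ∫⁻ ω, ⨆ t ∈ A, ENNReal.ofReal |Z t ω - Z (e t) ω| ∂P
        + 2 * ENNReal.ofReal (K * ε) * youngInv ψ (B.card : ℝ≥0∞) := by
  have hpt : ∀ ω, ⨆ t ∈ B, ENNReal.ofReal |Z t ω - Z (e (p t)) ω|
      ≤ (⨆ t ∈ A, ENNReal.ofReal |Z t ω - Z (e t) ω|)
        + ⨆ t ∈ B, ENNReal.ofReal |Z t ω - Z (p t) ω| := by
    intro ω
    refine iSup₂_le fun t ht => (ofReal_abs_sub_triangle _ (Z (p t) ω) _).trans ?_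
    rw [add_comm]
    exact add_le_add
      (le_iSup₂_of_le (f := fun t (_ : t ∈ A) => ENNReal.ofReal |Z t ω - Z (e t) ω|)
        (p t) (hpA t) le_rfl)
      (le_iSup₂_of_le (f := fun t (_ : t ∈ B) => ENNReal.ofReal |Z t ω - Z (p t) ω|) t ht le_rfl)
  refine (lintegral_mono hpt).trans ?_
  have hm := measurable_iSup_abs_sub hZ e A.countable_toSet
  simp only [Finset.mem_coe] at hm
  rw [lintegral_add_left hm]
  gcongr
  refine hψ.lintegral_iSup_le B (fun t ω => Z t ω - Z (p t) ω)
    (fun t _ => (hZ t).sub (hZ (p t))) fun t _ => (hZd _ _).trans_lt ?_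
  rw [hd.symm]
  have : 0 < ε := (hd.nonneg _ _).trans_lt (hpd t)
  exact (ENNReal.ofReal_lt_ofReal_iff (by positivity)).2 (mul_lt_mul_of_pos_left (hpd t) hK)

/-- One link of the chain is dominated by a piece of the entropy integral. -/
theorem link_le_entropy {ε : ℝ} (hK : 0 < K) {m : ℕ}
    (hm : (m : ℕ∞) ≤ coveringNumber d (ε / 2)) :
    2 * ENNReal.ofReal (K * ε) * youngInv ψ (m : ℝ≥0∞)
      ≤ 4 * ENNReal.ofReal K
        * ∫⁻ x in Set.Ioc (ε / 2) ε, youngInv ψ (coveringNumber d (x / 2) : ℝ≥0∞) := by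
  have h1 : youngInv ψ (m : ℝ≥0∞) * ENNReal.ofReal (ε / 2)
      ≤ ∫⁻ x in Set.Ioc (ε / 2) ε, youngInv ψ (coveringNumber d (x / 2) : ℝ≥0∞) := by
    -- On this interval of length ε/2 the radius x/2 is at most ε/2, so the covering number is at
    -- least m.
    have : ENNReal.ofReal (ε / 2) = volume (Set.Ioc (ε / 2) ε) := by
      rw [Real.volume_Ioc]; congr 1; ring
    rw [this, ← setLIntegral_const]
    refine setLIntegral_mono' measurableSet_Ioc fun x hx => youngInv_mono ψ ?_
    have := hm.trans (coveringNumber_anti d (show x / 2 ≤ ε / 2 by linarith [hx.2]))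
    exact_mod_cast this
  refine le_trans (le_of_eq ?_) (mul_le_mul_right h1 _)
  have h2 : ENNReal.ofReal (K * ε) = 2 * ENNReal.ofReal K * ENNReal.ofReal (ε / 2) := by
    rw [show K * ε = 2 * (K * (ε / 2)) by ring, ENNReal.ofReal_mul zero_le_two,
      ENNReal.ofReal_mul hK.le, mul_assoc]
    simp
  rw [h2]
  ring

/-- The link at each level is paid for by the entropy integral over its own dyadic interval. These
intervals are disjoint, so the bound does not deteriorate as J grows. -/
theorem exists_chain (hψ : IsYoung ψ) (hK : 0 < K) (hd : IsSemimetric d)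
    (hZ : ∀ t, Measurable (Z t))
    (hZd : ∀ s t, orliczNorm P ψ (fun ω => Z s ω - Z t ω) ≤ ENNReal.ofReal (K * d s t))
    {θ : ℝ} (hθ : 0 < θ) {S : ℕ → Finset T} {p : ℕ → T → T} (hpS : ∀ j t, p j t ∈ S j)
    (hpd : ∀ j t, d (p j t) t < θ / 2 ^ j)
    (hcard : ∀ j, ((S j).card : ℕ∞) ≤ coveringNumber d (θ / 2 ^ j)) (J : ℕ) :
    ∃ e : T → T, (∀ t ∈ S J, e t ∈ S 0) ∧
      ∫⁻ ω, ⨆ t ∈ S J, ENNReal.ofReal |Z t ω - Z (e t) ω| ∂P ≤ 4 * ENNReal.ofReal K *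
        ∫⁻ x in Set.Ioc (θ / 2 ^ J) θ, youngInv ψ (coveringNumber d (x / 2) : ℝ≥0∞) := by
  induction J with
  | zero => exact ⟨id, fun t ht => ht, by simp⟩
  | succ J ih =>
    obtain ⟨e, he, hle⟩ := ih
    refine ⟨fun t => e (p J t), fun t _ => he _ (hpS J t), ?_⟩
    refine (chain_step hψ hK hd hZ hZd (hpS J) (hpd J)).trans ?_
    have h2 : θ / 2 ^ (J + 1) = θ / 2 ^ J / 2 := by rw [pow_succ, div_div]
    have hpos : 0 < θ / 2 ^ J := by positivity
    refine (add_le_add hle (link_le_entropy hK (h2 ▸ hcard (J + 1)))).trans (le_of_eq ?_)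
    rw [← mul_add, add_comm, ← lintegral_union measurableSet_Ioc, Set.Ioc_union_Ioc_eq_Ioc, h2]
    · exact half_le_self hpos.le
    · exact div_le_self hθ.le (one_le_pow₀ one_le_two)
    · exact Set.Ioc_disjoint_Ioc_of_le le_rfl

open Classical in
-- Chain endpoints of a close pair need not be close. For each pair of endpoints that arises, one
-- close pair q with these endpoints is fixed, and s is joined to t by s, e s = e q₁, q₁, q₂, e q₂ =
-- e t, t. This costs four chain terms and one increment out of at most |S|² with distance below η.
theorem lintegral_modulus_le_of_finset (hψ : IsYoung ψ) (hK : 0 < K) (hd : IsSemimetric d)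
    (hZ : ∀ t, Measurable (Z t))
    (hZd : ∀ s t, orliczNorm P ψ (fun ω => Z s ω - Z t ω) ≤ ENNReal.ofReal (K * d s t))
    {A S : Finset T} {e : T → T} (he : ∀ t ∈ A, e t ∈ S) {η : ℝ} (hη : 0 < η) :
    ∫⁻ ω, modulus Z d A η ω ∂P
      ≤ 4 * ∫⁻ ω, ⨆ t ∈ A, ENNReal.ofReal |Z t ω - Z (e t) ω| ∂P
        + 2 * ENNReal.ofReal (K * η) * youngInv ψ ((S.card * S.card : ℕ) : ℝ≥0∞) := by
  let R : T × T → T × T → Prop := fun p q =>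
    q.1 ∈ A ∧ q.2 ∈ A ∧ d q.1 q.2 < η ∧ e q.1 = p.1 ∧ e q.2 = p.2
  -- The default is a diagonal pair, at distance 0 < η, so that every representative meets the
  -- distance bound.
  let r : T × T → T × T := fun p => if h : ∃ q, R p q then h.choose else (p.1, p.1)
  have hr : ∀ p, d (r p).1 (r p).2 < η := by
    intro p
    by_cases h : ∃ q, R p q
    · simp only [r, dif_pos h]
      exact h.choose_spec.2.2.1
    · simp only [r, dif_neg h, hd.self, hη]
  have hpt : ∀ ω, modulus Z d A η ω
      ≤ 4 * (⨆ t ∈ A, ENNReal.ofReal |Z t ω - Z (e t) ω|)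
        + ⨆ p ∈ S ×ˢ S, ENNReal.ofReal |Z (r p).1 ω - Z (r p).2 ω| := by
    intro ω
    refine iSup_le fun s => iSup_le fun t => iSup_le fun ⟨hs, ht, hst⟩ => ?_
    have hex : ∃ q, R (e s, e t) q := ⟨(s, t), hs, ht, hst, rfl, rfl⟩
    have hrR : R (e s, e t) (r (e s, e t)) := by
      simp only [r, dif_pos hex]
      exact hex.choose_spec
    set q := r (e s, e t) with hq
    obtain ⟨hq1, hq2, -, he1, he2⟩ := hrR
    set M := ⨆ t ∈ A, ENNReal.ofReal |Z t ω - Z (e t) ω| with hM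
    have hMle : ∀ u ∈ A, ENNReal.ofReal |Z u ω - Z (e u) ω| ≤ M := fun u hu =>
      le_iSup₂_of_le (f := fun t (_ : t ∈ A) => ENNReal.ofReal |Z t ω - Z (e t) ω|) u hu le_rfl
    have hMle' : ∀ u ∈ A, ENNReal.ofReal |Z (e u) ω - Z u ω| ≤ M := fun u hu => by
      rw [abs_sub_comm]; exact hMle u hu
    have hle : ENNReal.ofReal |Z q.1 ω - Z q.2 ω|
        ≤ ⨆ p ∈ S ×ˢ S, ENNReal.ofReal |Z (r p).1 ω - Z (r p).2 ω| :=
      le_iSup₂_of_le (f := fun p (_ : p ∈ S ×ˢ S) => ENNReal.ofReal |Z (r p).1 ω - Z (r p).2 ω|)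
        (e s, e t) (Finset.mem_product.2 ⟨he s hs, he t ht⟩) le_rfl
    calc ENNReal.ofReal |Z s ω - Z t ω|
        ≤ ENNReal.ofReal |Z s ω - Z (e s) ω| + (ENNReal.ofReal |Z (e s) ω - Z q.1 ω|
          + (ENNReal.ofReal |Z q.1 ω - Z q.2 ω| + (ENNReal.ofReal |Z q.2 ω - Z (e t) ω|
          + ENNReal.ofReal |Z (e t) ω - Z t ω|))) := by
          refine (ofReal_abs_sub_triangle _ (Z (e s) ω) _).trans (add_le_add_right ?_ _)
          refine (ofReal_abs_sub_triangle _ (Z q.1 ω) _).trans (add_le_add_right ?_ _)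
          refine (ofReal_abs_sub_triangle _ (Z q.2 ω) _).trans (add_le_add_right ?_ _)
          exact ofReal_abs_sub_triangle _ (Z (e t) ω) _
      _ ≤ M + (M + ((⨆ p ∈ S ×ˢ S, ENNReal.ofReal |Z (r p).1 ω - Z (r p).2 ω|) + (M + M))) := by
          have h1 : e s = e q.1 := he1.symm
          have h2 : e t = e q.2 := he2.symm
          refine add_le_add (hMle s hs) (add_le_add ?_ (add_le_add hle (add_le_add ?_ ?_)))
          · rw [h1]; exact hMle' _ hq1
          · rw [h2]; exact hMle _ hq2
          · exact hMle' t ht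
      _ = _ := by ring
  refine (lintegral_mono hpt).trans ?_
  have hm := measurable_iSup_abs_sub hZ e A.countable_toSet
  simp only [Finset.mem_coe] at hm
  rw [lintegral_add_left (hm.const_mul 4), lintegral_const_mul _ hm]
  gcongr
  rw [← Finset.card_product]
  refine hψ.lintegral_iSup_le (S ×ˢ S) (fun p ω => Z (r p).1 ω - Z (r p).2 ω)
    (fun p _ => (hZ _).sub (hZ _)) fun p _ => (hZd _ _).trans_lt ?_
  exact (ENNReal.ofReal_lt_ofReal_iff (by positivity)).2 (mul_lt_mul_of_pos_left (hr p) hK)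

end Chaining

/-! ### The expected modulus over countable index sets -/

theorem measurable_modulus {T Ω : Type*} [MeasurableSpace Ω] {Z : T → Ω → ℝ}
    (hZ : ∀ t, Measurable (Z t)) (d : T → T → ℝ) {S : Set T} (hS : S.Countable) (η : ℝ) :
    Measurable (modulus Z d S η) := by
  have h : modulus Z d S η = fun ω => ⨆ p ∈ {p : T × T | p.1 ∈ S ∧ p.2 ∈ S ∧ d p.1 p.2 < η},
      ENNReal.ofReal |Z p.1 ω - Z p.2 ω| := by
    funext ω
    simp only [modulus, iSup_prod, Set.mem_ofPred_eq]
  rw [h]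
  have hc : {p : T × T | p.1 ∈ S ∧ p.2 ∈ S ∧ d p.1 p.2 < η}.Countable :=
    (hS.prod hS).mono fun p (hp : p.1 ∈ S ∧ p.2 ∈ S ∧ d p.1 p.2 < η) =>
      Set.mk_mem_prod hp.1 hp.2.1
  refine Measurable.biSup _ hc fun p _ => ?_
  exact (measurable_abs.comp ((hZ p.1).sub (hZ p.2))).ennreal_ofReal

theorem modulus_mono {T Ω : Type*} (Z : T → Ω → ℝ) (d : T → T → ℝ) {S S' : Set T} (hS : S ⊆ S')
    {η η' : ℝ} (hη : η ≤ η') (ω : Ω) : modulus Z d S η ω ≤ modulus Z d S' η' ω :=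
  iSup_mono fun _ => iSup_mono fun _ => iSup_mono' fun h =>
    ⟨⟨hS h.1, hS h.2.1, h.2.2.trans_le hη⟩, le_rfl⟩

/-- A bound on the expected modulus over finite sets extends to countable sets. -/
theorem lintegral_modulus_le_of_forall_finset {T Ω : Type*} [MeasurableSpace Ω] {P : Measure Ω}
    {Z : T → Ω → ℝ} (hZ : ∀ t, Measurable (Z t)) {d : T → T → ℝ} {η : ℝ} {c : ℝ≥0∞}
    (h : ∀ A : Finset T, ∫⁻ ω, modulus Z d A η ω ∂P ≤ c) {S : Set T} (hS : S.Countable) :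
    ∫⁻ ω, modulus Z d S η ω ∂P ≤ c := by
  classical
  rcases S.eq_empty_or_nonempty with rfl | hne
  · simpa using h ∅
  obtain ⟨f, rfl⟩ := hS.exists_eq_range hne
  let A : ℕ → Finset T := fun k => (Finset.range k).image f
  have hA : Monotone A := fun i j hij => Finset.image_subset_image (Finset.range_mono hij)
  have heq : ∀ ω, modulus Z d (Set.range f) η ω = ⨆ k, modulus Z d (A k) η ω := by
    intro ω
    refine le_antisymm ?_ (iSup_le fun k => modulus_mono Z d ?_ le_rfl ω)
    · refine iSup_le fun s => iSup_le fun t => iSup_le ?_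
      rintro ⟨⟨i, rfl⟩, ⟨j, rfl⟩, hst⟩
      refine le_iSup_of_le (max i j + 1) (le_iSup₂_of_le (f i) (f j)
        (le_iSup_of_le ⟨?_, ?_, hst⟩ le_rfl))
      · exact Finset.mem_coe.2 (Finset.mem_image_of_mem f (Finset.mem_range.2 (by omega)))
      · exact Finset.mem_coe.2 (Finset.mem_image_of_mem f (Finset.mem_range.2 (by omega)))
    · intro x hx
      obtain ⟨i, -, rfl⟩ := Finset.mem_image.1 (Finset.mem_coe.1 hx)
      exact ⟨i, rfl⟩
  simp only [heq]
  rw [lintegral_iSup (fun k => measurable_modulus hZ d (A k).countable_toSet η)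
    fun i j hij ω => modulus_mono Z d (Finset.coe_subset.2 (hA hij)) le_rfl ω]
  exact iSup_le fun k => h (A k)

/-- The chaining bound: the expected modulus of continuity over countable sets is small, uniformly
over all processes with the same Lipschitz constant for the Orlicz norm. -/
theorem exists_lintegral_modulus_le {T Ω : Type*} [Nonempty T] [MeasurableSpace Ω] (P : Measure Ω)
    [IsProbabilityMeasure P] {ψ : ℝ → ℝ} {d : T → T → ℝ} {K : ℝ} (hψ : IsYoung ψ) (hK : 0 < K)
    (hd : IsSemimetric d) (hent : entropyIntegral ψ d < ⊤) {ε : ℝ} (hε : 0 < ε) :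
    ∃ η : ℝ, 0 < η ∧ ∀ Z : T → Ω → ℝ, (∀ t, Measurable (Z t)) →
      (∀ s t, orliczNorm P ψ (fun ω => Z s ω - Z t ω) ≤ ENNReal.ofReal (K * d s t)) →
      ∀ S : Set T, S.Countable → ∫⁻ ω, modulus Z d S η ω ∂P ≤ ENNReal.ofReal ε := by
  obtain ⟨r, hr, hint⟩ := exists_entropy_near_zero hψ hent
  -- The four chain terms cost 16K times the entropy integral over (0, θ], which is to be at most
  -- ε/2.
  obtain ⟨δ, hδ, hδs⟩ := exists_pos_setLIntegral_lt_of_measure_lt hint.ne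
    (ENNReal.ofReal_pos.2 (show 0 < ε / (32 * K) by positivity)).ne'
  obtain ⟨θ₀, -, hθ₀, hθ₀δ⟩ := ENNReal.lt_iff_exists_real_btwn.1 hδ
  set θ := min θ₀ r with hθdef
  have hθ : 0 < θ := lt_min (ENNReal.ofReal_pos.1 hθ₀) hr
  set I := ∫⁻ x in Set.Ioc 0 θ, youngInv ψ (coveringNumber d (x / 2) : ℝ≥0∞) with hI
  have hIlt : I ≤ ENNReal.ofReal (ε / (32 * K)) := by
    have h1 := hδs (Set.Ioc 0 θ) (lt_of_le_of_lt (Measure.restrict_apply_le _ _) (by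
      rw [Real.volume_Ioc, sub_zero]
      exact (ENNReal.ofReal_le_ofReal (min_le_left _ _)).trans_lt hθ₀δ))
    rw [Measure.restrict_restrict measurableSet_Ioc, Set.inter_eq_self_of_subset_left
      (Set.Ioc_subset_Ioc_right (min_le_right _ _))] at h1
    exact h1.le
  have hcov : ∀ j : ℕ, ∃ S : Finset T, (∀ t, ∃ s ∈ S, d s t < θ / 2 ^ j) ∧
      (S.card : ℕ∞) ≤ coveringNumber d (θ / 2 ^ j) := fun j =>
    exists_cover_card_le (coveringNumber_ne_top_of_entropy hψ hent (by positivity))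
  choose S hS hcard using hcov
  choose p hpS hpd using hS
  set y := youngInv ψ (((S 0).card * (S 0).card : ℕ) : ℝ≥0∞) with hy
  have hyt : y < ⊤ := hψ.youngInv_lt_top (ENNReal.natCast_lt_top _)
  -- Chosen so that 2Kη(y + 1) = ε/2; the level-0 net, and hence y, is already fixed.
  have hη : 0 < ε / (4 * K * (y.toReal + 1)) := by positivity
  refine ⟨ε / (4 * K * (y.toReal + 1)), hη, fun Z hZ hZd A hA =>
    lintegral_modulus_le_of_forall_finset hZ (fun A => ?_) hA⟩
  set η := ε / (4 * K * (y.toReal + 1)) with hηdef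
  -- The link from A to level J involves the cardinality of A, but carries the factor θ/2^J and
  -- vanishes as J → ∞ with A fixed.
  have hbound : ∀ J : ℕ, ∫⁻ ω, modulus Z d A η ω ∂P ≤ 4 * (4 * ENNReal.ofReal K * I
      + 2 * ENNReal.ofReal (K * (θ / 2 ^ J)) * youngInv ψ (A.card : ℝ≥0∞))
      + 2 * ENNReal.ofReal (K * η) * y := by
    intro J
    obtain ⟨e, he, hle⟩ := exists_chain hψ hK hd hZ hZd hθ hpS hpd hcard J
    refine (lintegral_modulus_le_of_finset hψ hK hd hZ hZd (A := A) (S := S 0)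
      (e := fun t => e (p J t)) (fun t _ => he _ (hpS J t)) hη).trans ?_
    gcongr
    refine (chain_step hψ hK hd hZ hZd (hpS J) (hpd J)).trans ?_
    gcongr
    refine hle.trans (mul_le_mul_right (lintegral_mono_set (Set.Ioc_subset_Ioc_left ?_)) _)
    positivity
  have hlim : Tendsto (fun J : ℕ => 4 * (4 * ENNReal.ofReal K * I
      + 2 * ENNReal.ofReal (K * (θ / 2 ^ J)) * youngInv ψ (A.card : ℝ≥0∞))
      + 2 * ENNReal.ofReal (K * η) * y) atTop
      (𝓝 (4 * (4 * ENNReal.ofReal K * I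
        + 2 * ENNReal.ofReal (K * 0) * youngInv ψ (A.card : ℝ≥0∞))
        + 2 * ENNReal.ofReal (K * η) * y)) := by
    have h1 : Tendsto (fun J : ℕ => θ / 2 ^ J) atTop (𝓝 0) :=
      tendsto_const_nhds.div_atTop (tendsto_pow_atTop_atTop_of_one_lt one_lt_two)
    have h2 := ENNReal.tendsto_ofReal (h1.const_mul K)
    have hAt : youngInv ψ (A.card : ℝ≥0∞) ≠ ⊤ := (hψ.youngInv_lt_top (by simp)).ne
    refine Tendsto.add (ENNReal.Tendsto.const_mul (Tendsto.add tendsto_const_nhds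
      (ENNReal.Tendsto.mul_const (ENNReal.Tendsto.const_mul h2 (by simp)) (by simp [hAt])))
      (by simp)) tendsto_const_nhds
  refine (ge_of_tendsto' hlim hbound).trans ?_
  have e1 : 4 * (4 * ENNReal.ofReal K * I) ≤ ENNReal.ofReal (ε / 2) := by
    calc 4 * (4 * ENNReal.ofReal K * I)
        ≤ 4 * (4 * ENNReal.ofReal K * ENNReal.ofReal (ε / (32 * K))) := by gcongr
      _ = ENNReal.ofReal (4 * (4 * K * (ε / (32 * K)))) := by
          rw [ENNReal.ofReal_mul (by norm_num), ENNReal.ofReal_mul (by positivity),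
            ENNReal.ofReal_mul (by norm_num)]
          simp
      _ = ENNReal.ofReal (ε / 2) := by congr 1; field_simp; norm_num
  have e2 : 2 * ENNReal.ofReal (K * η) * y ≤ ENNReal.ofReal (ε / 2) := by
    calc 2 * ENNReal.ofReal (K * η) * y = ENNReal.ofReal (2 * (K * η) * y.toReal) := by
          rw [ENNReal.ofReal_mul (p := 2 * (K * η)) (by positivity),
            ENNReal.ofReal_mul (p := 2) (by norm_num), ENNReal.ofReal_toReal hyt.ne]
          simp
      _ ≤ ENNReal.ofReal (ε / 2) := by
          refine ENNReal.ofReal_le_ofReal ?_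
          have : 2 * (K * η) * (y.toReal + 1) = ε / 2 := by
            rw [hηdef]; field_simp; norm_num
          have h3 : 0 ≤ 2 * (K * η) := by positivity
          nlinarith
  rw [mul_zero, ENNReal.ofReal_zero, mul_zero, zero_mul, add_zero]
  refine (add_le_add e1 e2).trans (le_of_eq ?_)
  rw [← ENNReal.ofReal_add (by positivity) (by positivity), add_halves]

/-! Outer expectations -/

theorem outerExpectation_mono {Ω : Type*} [MeasurableSpace Ω] {P : Measure Ω} {Y Y' : Ω → ℝ}
    (h : ∀ ω, Y ω ≤ Y' ω) : outerExpectation P Y ≤ outerExpectation P Y' :=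
  iInf_mono fun _ => iInf_mono' fun hU =>
    ⟨⟨hU.1, fun ω => (EReal.coe_le_coe_iff.2 (h ω)).trans (hU.2.1 ω), hU.2.2⟩, le_rfl⟩

theorem lintegral_ofReal_ne_top {Ω : Type*} [MeasurableSpace Ω] {P : Measure Ω} {U : Ω → ℝ}
    (hU : Integrable U P) : ∫⁻ ω, ENNReal.ofReal (U ω) ∂P ≠ ⊤ :=
  ((lintegral_mono fun ω => Real.ofReal_le_enorm (U ω)).trans_lt hU.2).ne

theorem coe_integral_eq_sub {Ω : Type*} [MeasurableSpace Ω] {P : Measure Ω} {U : Ω → ℝ}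
    (hU : Integrable U P) : ((∫ ω, U ω ∂P : ℝ) : EReal)
      = ((∫⁻ ω, ENNReal.ofReal (U ω) ∂P : ℝ≥0∞) : EReal)
        - ((∫⁻ ω, ENNReal.ofReal (-U ω) ∂P : ℝ≥0∞) : EReal) := by
  rw [integral_eq_lintegral_pos_part_sub_lintegral_neg_part hU, EReal.coe_sub,
    EReal.coe_ennreal_toReal (lintegral_ofReal_ne_top hU),
    EReal.coe_ennreal_toReal (lintegral_ofReal_ne_top (U := fun ω => -U ω) hU.neg)]

theorem outerExpectation_le_integral {Ω : Type*} [MeasurableSpace Ω] {P : Measure Ω}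
    {Y U : Ω → ℝ} (hU : Measurable U) (hint : Integrable U P) (h : ∀ ω, Y ω ≤ U ω) :
    outerExpectation P Y ≤ ((∫ ω, U ω ∂P : ℝ) : EReal) := by
  rw [coe_integral_eq_sub hint]
  refine iInf₂_le_of_le (fun ω => (U ω : EReal)) ⟨measurable_coe_real_ereal.comp hU,
    fun ω => EReal.coe_le_coe_iff.2 (h ω), Or.inl (lintegral_ofReal_ne_top hint)⟩ le_rfl

theorem integral_le_outerExpectation {Ω : Type*} [MeasurableSpace Ω] {P : Measure Ω}
    {Y W : Ω → ℝ} (hint : Integrable W P) (h : ∀ ω, W ω ≤ Y ω) :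
    ((∫ ω, W ω ∂P : ℝ) : EReal) ≤ outerExpectation P Y := by
  rw [coe_integral_eq_sub hint]
  refine le_iInf₂ fun U hU => EReal.sub_le_sub ?_ ?_
  · refine EReal.coe_ennreal_le_coe_ennreal_iff.2 (lintegral_mono fun ω => ?_)
    rw [← EReal.real_coe_toENNReal]
    exact EReal.toENNReal_le_toENNReal ((EReal.coe_le_coe_iff.2 (h ω)).trans (hU.2.1 ω))
  · refine EReal.coe_ennreal_le_coe_ennreal_iff.2 (lintegral_mono fun ω => ?_)
    rw [← EReal.real_coe_toENNReal, EReal.coe_neg]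
    exact EReal.toENNReal_le_toENNReal
      (EReal.neg_le_neg_iff.2 ((EReal.coe_le_coe_iff.2 (h ω)).trans (hU.2.1 ω)))

theorem outerExpectation_eq_integral {Ω : Type*} [MeasurableSpace Ω] {P : Measure Ω}
    {U : Ω → ℝ} (hU : Measurable U) (hint : Integrable U P) :
    outerExpectation P U = ((∫ ω, U ω ∂P : ℝ) : EReal) :=
  le_antisymm (outerExpectation_le_integral hU hint fun _ => le_rfl)
    (integral_le_outerExpectation hint fun _ => le_rfl)

theorem tendsto_ereal_of_forall_eps {ι : Type*} {l : Filter ι} {u : ι → EReal} {b : ℝ}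
    (h : ∀ ε : ℝ, 0 < ε → ∀ᶠ n in l, ((b - ε : ℝ) : EReal) ≤ u n ∧ u n ≤ ((b + ε : ℝ) : EReal)) :
    Tendsto u l (𝓝 (b : EReal)) := by
  rw [tendsto_order]
  constructor
  · intro a ha
    obtain ⟨c, hac, hcb⟩ := EReal.lt_iff_exists_real_btwn.1 ha
    have hcb' : c < b := EReal.coe_lt_coe_iff.1 hcb
    filter_upwards [h (b - c) (sub_pos.2 hcb')] with n hn
    have := hn.1
    rw [sub_sub_cancel] at this
    exact hac.trans_le this
  · intro a ha
    obtain ⟨c, hbc, hca⟩ := EReal.lt_iff_exists_real_btwn.1 ha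
    have hbc' : b < c := EReal.coe_lt_coe_iff.1 hbc
    filter_upwards [h (c - b) (sub_pos.2 hbc')] with n hn
    have := hn.2
    rw [add_sub_cancel] at this
    exact this.trans_lt hca

/-! Lipschitz approximation of bounded continuous functions -/

theorem lipschitzWith_iInf_add_mul_dist {E : Type*} [PseudoMetricSpace E] (h : E →ᵇ ℝ) (k : ℕ) :
    LipschitzWith k fun x => ⨅ y, (h y + k * dist x y) := by
  rcases isEmpty_or_nonempty E with hE | hE
  · exact fun x => (hE.false x).elim
  have hb : ∀ x, BddBelow (Set.range fun y => h y + k * dist x y) := fun x => by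
    refine ⟨-‖h‖, ?_⟩
    rintro _ ⟨y, rfl⟩
    have h1 := (abs_le.1 (h.norm_coe_le_norm y)).1
    have h2 : 0 ≤ (k : ℝ) * dist x y := by positivity
    linarith
  refine LipschitzWith.of_le_add_mul _ fun x x' => ?_
  rw [← sub_le_iff_le_add]
  refine le_ciInf fun y => ?_
  have h1 : (⨅ y, (h y + k * dist x y)) ≤ h y + k * dist x y := ciInf_le (hb x) y
  have h2 : (k : ℝ) * dist x y ≤ k * (dist x x' + dist x' y) :=
    mul_le_mul_of_nonneg_left (dist_triangle _ _ _) (by positivity)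
  simp only [NNReal.coe_natCast]
  linarith

/-- The largest `k`-Lipschitz minorant of a bounded continuous function. -/
def lipschitzMinorant {E : Type*} [PseudoMetricSpace E] (h : E →ᵇ ℝ) (k : ℕ) : E →ᵇ ℝ :=
  BoundedContinuousFunction.ofNormedAddCommGroup (fun x => ⨅ y, (h y + k * dist x y))
    (lipschitzWith_iInf_add_mul_dist h k).continuous ‖h‖ fun x => by
      have : Nonempty E := ⟨x⟩
      have hb : ∀ y, -‖h‖ ≤ h y + k * dist x y := fun y => by
        have h1 := (abs_le.1 (h.norm_coe_le_norm y)).1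
        have h2 : 0 ≤ (k : ℝ) * dist x y := by positivity
        linarith
      rw [Real.norm_eq_abs, abs_le]
      refine ⟨le_ciInf hb, ?_⟩
      refine (ciInf_le ⟨-‖h‖, by rintro _ ⟨y, rfl⟩; exact hb y⟩ x).trans ?_
      simpa using (abs_le.1 (h.norm_coe_le_norm x)).2

theorem lipschitzMinorant_le {E : Type*} [PseudoMetricSpace E] (h : E →ᵇ ℝ) (k : ℕ) (x : E) :
    lipschitzMinorant h k x ≤ h x := by
  have hb : BddBelow (Set.range fun y => h y + k * dist x y) := by
    refine ⟨-‖h‖, ?_⟩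
    rintro _ ⟨y, rfl⟩
    have h1 := (abs_le.1 (h.norm_coe_le_norm y)).1
    have h2 : 0 ≤ (k : ℝ) * dist x y := by positivity
    linarith
  exact (ciInf_le hb x).trans (by simp)

theorem abs_lipschitzMinorant_le {E : Type*} [PseudoMetricSpace E] (h : E →ᵇ ℝ) (k : ℕ) (x : E) :
    |lipschitzMinorant h k x| ≤ ‖h‖ := by
  have : Nonempty E := ⟨x⟩
  rw [abs_le]
  refine ⟨le_ciInf fun y => ?_, (lipschitzMinorant_le h k x).trans
    (abs_le.1 (h.norm_coe_le_norm x)).2⟩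
  have h1 := (abs_le.1 (h.norm_coe_le_norm y)).1
  have h2 : 0 ≤ (k : ℝ) * dist x y := by positivity
  linarith

/-- Near x the values of h exceed any c < h(x) by continuity; at distance at least δ the penalty kδ
outweighs a drop of h to -‖h‖ once k is large. -/
theorem tendsto_lipschitzMinorant {E : Type*} [PseudoMetricSpace E] (h : E →ᵇ ℝ) (x : E) :
    Tendsto (fun k => lipschitzMinorant h k x) atTop (𝓝 (h x)) := by
  have : Nonempty E := ⟨x⟩
  refine tendsto_order.2 ⟨fun a ha => ?_, fun a ha =>
    Eventually.of_forall fun k => (lipschitzMinorant_le h k x).trans_lt ha⟩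
  obtain ⟨c, hac, hch⟩ := exists_between ha
  obtain ⟨δ, hδ, hδh⟩ := Metric.eventually_nhds_iff.1 (h.continuous.continuousAt.eventually
    (lt_mem_nhds hch))
  obtain ⟨k₀, hk₀⟩ := exists_nat_gt ((c + ‖h‖) / δ)
  filter_upwards [eventually_ge_atTop k₀] with k hk
  refine hac.trans_le (le_ciInf fun y => ?_)
  by_cases hy : dist y x < δ
  · have h2 : 0 ≤ (k : ℝ) * dist x y := by positivity
    linarith [hδh hy]
  · have h1 := (abs_le.1 (h.norm_coe_le_norm y)).1
    have h2 : (k : ℝ) * δ ≤ k * dist x y := by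
      rw [dist_comm]
      exact mul_le_mul_of_nonneg_left (not_lt.1 hy) (by positivity)
    have h3 : (k₀ : ℝ) * δ ≤ k * δ := by gcongr
    have h4 := (div_lt_iff₀ hδ).1 hk₀
    linarith

theorem exists_lipschitz_minorant {E : Type*} [PseudoMetricSpace E] [MeasurableSpace E]
    [OpensMeasurableSpace E] (μ : Measure E) [IsFiniteMeasure μ] (h : E →ᵇ ℝ) {ε : ℝ}
    (hε : 0 < ε) : ∃ g : E →ᵇ ℝ, (∃ L, LipschitzWith L g) ∧ (∀ x, g x ≤ h x) ∧
      ∫ x, h x ∂μ - ε < ∫ x, g x ∂μ := by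
  have hlim : Tendsto (fun k => ∫ x, lipschitzMinorant h k x ∂μ) atTop (𝓝 (∫ x, h x ∂μ)) := by
    refine tendsto_integral_of_dominated_convergence (fun _ => ‖h‖)
      (fun k => (lipschitzMinorant h k).continuous.measurable.aestronglyMeasurable)
      (integrable_const _) (fun k => Eventually.of_forall fun x => abs_lipschitzMinorant_le h k x)
      (Eventually.of_forall fun x => tendsto_lipschitzMinorant h x)
  obtain ⟨k, hk⟩ := (hlim.eventually (lt_mem_nhds (sub_lt_self _ hε))).exists
  exact ⟨lipschitzMinorant h k, ⟨k, lipschitzWith_iInf_add_mul_dist h k⟩,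
    lipschitzMinorant_le h k, hk⟩

/-- Weak convergence may be checked on Lipschitz functions. -/
theorem weaklyConverges_of_lipschitz {Ω E : Type*} [MeasurableSpace Ω] [PseudoMetricSpace E]
    [MeasurableSpace E] [OpensMeasurableSpace E] {P : Measure Ω} {Y : ℕ → Ω → E} {μ : Measure E}
    [IsFiniteMeasure μ]
    (H : ∀ (h : E →ᵇ ℝ) (L : NNReal), LipschitzWith L h → ∀ ε : ℝ, 0 < ε → ∀ᶠ n in atTop,
      ((∫ x, h x ∂μ - ε : ℝ) : EReal) ≤ outerExpectation P (fun ω => h (Y n ω)) ∧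
      outerExpectation P (fun ω => h (Y n ω)) ≤ ((∫ x, h x ∂μ + ε : ℝ) : EReal)) :
    WeaklyConverges P Y μ := by
  intro h
  refine tendsto_ereal_of_forall_eps fun ε hε => ?_
  obtain ⟨g, ⟨L, hL⟩, hgh, hg⟩ := exists_lipschitz_minorant μ h (half_pos hε)
  -- The negative of a Lipschitz minorant of -h is a Lipschitz majorant of h, which serves the upper
  -- bound.
  obtain ⟨g', ⟨L', hL'⟩, hgh', hg'⟩ := exists_lipschitz_minorant μ (-h) (half_pos hε)
  have hneg : LipschitzWith L' (-g') := fun x y => by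
    simpa [edist_neg_neg] using hL' x y
  have e1 : ∫ x, (-h) x ∂μ = -∫ x, h x ∂μ := by
    rw [← integral_neg]; rfl
  have e2 : ∫ x, (-g') x ∂μ = -∫ x, g' x ∂μ := by
    rw [← integral_neg]; rfl
  filter_upwards [H g L hL _ (half_pos hε), H (-g') L' hneg _ (half_pos hε)] with n h1 h2
  constructor
  · refine le_trans (EReal.coe_le_coe_iff.2 ?_) (h1.1.trans (outerExpectation_mono fun ω => hgh _))
    linarith
  · refine le_trans (h2.2.trans' (outerExpectation_mono fun ω => ?_)) (EReal.coe_le_coe_iff.2 ?_)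
    · have := hgh' (Y n ω)
      simp only [BoundedContinuousFunction.coe_neg, Pi.neg_apply] at this ⊢
      linarith
    · linarith

/-! Step functions in `ℓ^∞` -/

/-- The step function `t ↦ x (p t)` determined by finitely many values. -/
def stepMap {T : Type*} {I : Finset T} {p : T → T} (hp : ∀ t, p t ∈ I) (x : I → ℝ) :
    EllInfty T :=
  ⟨fun t => x ⟨p t, hp t⟩, memℓp_infty ⟨‖x‖, by rintro _ ⟨t, rfl⟩; exact norm_le_pi_norm x _⟩⟩

theorem stepMap_apply {T : Type*} {I : Finset T} {p : T → T} (hp : ∀ t, p t ∈ I) (x : I → ℝ)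
    (t : T) : stepMap hp x t = x ⟨p t, hp t⟩ := rfl

theorem dist_ellInfty_le {T : Type*} {z w : EllInfty T} {C : ℝ} (hC : 0 ≤ C)
    (h : ∀ t, |z t - w t| ≤ C) : dist z w ≤ C := by
  rw [dist_eq_norm]
  exact lp.norm_le_of_forall_le hC h

theorem lipschitzWith_stepMap {T : Type*} {I : Finset T} {p : T → T} (hp : ∀ t, p t ∈ I) :
    LipschitzWith 1 (stepMap hp) := by
  refine LipschitzWith.of_dist_le_mul fun x y => ?_
  rw [NNReal.coe_one, one_mul]
  refine dist_ellInfty_le dist_nonneg fun t => ?_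
  rw [stepMap_apply, stepMap_apply, ← Real.dist_eq]
  exact dist_le_pi_dist x y _

theorem continuous_eval_ellInfty {T : Type*} (I : Finset T) :
    Continuous fun (z : EllInfty T) (t : I) => z t := by
  refine continuous_pi fun t => ?_
  refine LipschitzWith.continuous (K := 1) (LipschitzWith.of_dist_le_mul fun z w => ?_)
  rw [NNReal.coe_one, one_mul, dist_eq_norm z w, Real.dist_eq]
  exact lp.norm_apply_le_norm (by simp) (z - w) (t : T)

theorem toEllInfty_apply {T : Type*} {z : T → ℝ} (hz : Memℓp z ∞) (t : T) :
    toEllInfty z t = z t := by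
  rw [toEllInfty, dif_pos hz]

/-! Weak limits of asymptotically equicontinuous processes -/

/-- Uniform approximation by compact sets at every fine scale gives total boundedness, and
completeness does the rest. -/
theorem isCompact_closure_of_approx {E : Type*} [PseudoMetricSpace E] [CompleteSpace E]
    {C : ℕ → Set E} (hC : ∀ j, IsCompact (C j)) (k : ℕ) :
    IsCompact (closure {z : E | ∀ j, k ≤ j → ∃ w ∈ C j, dist z w ≤ (1 / 2 : ℝ) ^ j}) := by
  refine TotallyBounded.isCompact_of_isClosed (TotallyBounded.closure ?_) isClosed_closure
  refine Metric.totallyBounded_iff.2 fun ε hε => ?_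
  obtain ⟨j, hj⟩ := exists_pow_lt_of_lt_one (half_pos hε) (show (1 / 2 : ℝ) < 1 by norm_num)
  obtain ⟨t, ht, htC⟩ := Metric.totallyBounded_iff.1 (hC (max j k)).totallyBounded _ (half_pos hε)
  refine ⟨t, ht, fun z hz => ?_⟩
  obtain ⟨w, hw, hzw⟩ := hz (max j k) (le_max_right _ _)
  obtain ⟨y, hy, hwy⟩ := Set.mem_iUnion₂.1 (htC hw)
  refine Set.mem_iUnion₂.2 ⟨y, hy, ?_⟩
  have h1 : (1 / 2 : ℝ) ^ max j k ≤ (1 / 2) ^ j :=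
    pow_le_pow_of_le_one (by norm_num) (by norm_num) (le_max_left _ _)
  have h2 := Metric.mem_ball.1 hwy
  have h3 := dist_triangle z w y
  exact Metric.mem_ball.2 (by linarith)

theorem exists_antitone_le {δ : ℕ → ℝ} (hδ : ∀ j, 0 < δ j) :
    ∃ r : ℕ → ℝ, Antitone r ∧ ∀ j, 0 < r j ∧ r j ≤ δ j := by
  refine ⟨fun j => (Finset.range (j + 1)).inf' ⟨j, by simp⟩ δ, fun i j hij =>
    Finset.inf'_mono _ (Finset.range_mono (by omega)) _, fun j => ⟨?_, ?_⟩⟩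
  · exact (Finset.lt_inf'_iff _).2 fun i _ => hδ i
  · exact Finset.inf'_le _ (by simp)

/-- The set of values with an oscillation larger than `ε` at scale `δ`. -/
def oscillating {T : Type*} (d : T → T → ℝ) (δ ε : ℝ) : Set (T → ℝ) :=
  {z | ∃ s t, d s t ≤ δ ∧ ε < |z s - z t|}

section

variable {T Ω : Type*} [MeasurableSpace Ω] {P : Measure Ω}
  {Z : ℕ → T → Ω → ℝ} {d : T → T → ℝ} {ν : (I : Finset T) → Measure (I → ℝ)}

theorem AsympEquicontinuous.eventually_measure_le (hA : AsympEquicontinuous P Z d) {ε : ℝ}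
    (hε : 0 < ε) {γ : ℝ≥0∞} (hγ : 0 < γ) : ∃ δ : ℝ, 0 < δ ∧ ∀ δ' : ℝ, 0 < δ' → δ' ≤ δ →
      ∀ᶠ n in atTop, P {ω | (fun t => Z n t ω) ∈ oscillating d δ' ε} ≤ γ := by
  have h1 := (hA ε hε).eventually (gt_mem_nhds hγ)
  obtain ⟨δ, hδ, hδs⟩ := mem_nhdsGT_iff_exists_Ioc_subset.1 h1
  refine ⟨δ, hδ, fun δ' h0 h2 => ?_⟩
  have h3 : limsup (fun n : ℕ => P {ω | ENNReal.ofReal ε <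
      ⨆ (s : T) (t : T) (_ : d s t ≤ δ'), ENNReal.ofReal |Z n s ω - Z n t ω|}) atTop < γ :=
    hδs ⟨h0, h2⟩
  filter_upwards [eventually_lt_of_limsup_lt h3] with n hn
  refine (measure_mono ?_).trans hn.le
  rintro ω ⟨s, t, hst, hlt⟩
  exact lt_of_lt_of_le ((ENNReal.ofReal_lt_ofReal_iff_of_nonneg hε.le).2 hlt)
    (le_iSup₂_of_le s t (le_iSup_of_le hst le_rfl))

/-- Nets `p j` with values in finite sets `I j`, whose mesh is so fine that oscillations larger
than `2 ^ (-j)` at three times the scale of the mesh are unlikely. -/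
structure IsChainOfNets (P : Measure Ω) (Z : ℕ → T → Ω → ℝ) (d : T → T → ℝ) (I : ℕ → Finset T)
    (p : ℕ → T → T) (r : ℕ → ℝ) : Prop where
  mem : ∀ j t, p j t ∈ I j
  dist_le : ∀ j t, d (p j t) t ≤ r j
  antitone : Antitone r
  pos : ∀ j, 0 < r j
  oscillation : ∀ j, ∀ᶠ n in atTop,
    P {ω | (fun t => Z n t ω) ∈ oscillating d (3 * r j) ((1 / 2) ^ j)} ≤ 2⁻¹ ^ j

theorem AsympEquicontinuous.exists_nets (hA : AsympEquicontinuous P Z d)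
    (htb : ∀ r : ℝ, 0 < r → ∃ S : Finset T, ∀ t, ∃ s ∈ S, d s t < r) :
    ∃ I p r, IsChainOfNets P Z d I p r := by
  have h1 : ∀ j : ℕ, ∃ δ : ℝ, 0 < δ ∧ ∀ δ' : ℝ, 0 < δ' → δ' ≤ δ → ∀ᶠ n in atTop,
      P {ω | (fun t => Z n t ω) ∈ oscillating d δ' ((1 / 2) ^ j)} ≤ 2⁻¹ ^ j := fun j =>
    hA.eventually_measure_le (by positivity) (ENNReal.pow_pos (by simp) j)
  choose δ hδ hδP using h1
  -- The factor 3 leaves room for the triangle inequality that compares two nets in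
  -- `IsChainOfNets.exists_compact`.
  obtain ⟨r, hr, hrδ⟩ := exists_antitone_le fun j => div_pos (hδ j) (show (0 : ℝ) < 3 by norm_num)
  choose I hI using fun j => htb (r j) (hrδ j).1
  choose p hp hpd using hI
  exact ⟨I, p, r, hp, fun j t => (hpd j t).le, hr, fun j => (hrδ j).1, fun j =>
    hδP j _ (by linarith [(hrδ j).1]) (by linarith [(hrδ j).2])⟩

variable [IsProbabilityMeasure P]

theorem measurable_marginal {Z : T → Ω → ℝ} (hZ : ∀ t, Measurable (Z t)) (I : Finset T) :
    Measurable fun ω (t : I) => Z t ω :=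
  measurable_pi_lambda _ fun t => hZ t

/-- The laws of the marginals as probability measures. -/
def marginalLaw (P : Measure Ω) [IsProbabilityMeasure P] {Z : T → Ω → ℝ}
    (hZ : ∀ t, Measurable (Z t)) (I : Finset T) : ProbabilityMeasure (I → ℝ) :=
  ⟨P.map fun ω (t : I) => Z t ω, Measure.isProbabilityMeasure_map
    (measurable_marginal hZ I).aemeasurable⟩

theorem FidiConverges.tendsto_marginalLaw (hf : FidiConverges P Z ν)
    (hν : ∀ I, IsProbabilityMeasure (ν I)) (hZ : ∀ n t, Measurable (Z n t)) (I : Finset T) :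
    Tendsto (fun n => marginalLaw P (hZ n) I) atTop
      (𝓝 (⟨ν I, hν I⟩ : ProbabilityMeasure (I → ℝ))) := by
  refine ProbabilityMeasure.tendsto_iff_forall_integral_tendsto.2 fun h => ?_
  refine (hf I h).congr fun n => ?_
  exact (integral_map (measurable_marginal (hZ n) I).aemeasurable
    h.continuous.measurable.aestronglyMeasurable).symm

/-- The portmanteau theorem carries bounds from the processes to the limit marginals. The strict
inequality in `oscillating` makes the relevant sets open. -/
theorem FidiConverges.measure_open_le (hf : FidiConverges P Z ν)
    (hν : ∀ I, IsProbabilityMeasure (ν I)) (hZ : ∀ n t, Measurable (Z n t)) {I : Finset T}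
    {G : Set (I → ℝ)} (hG : IsOpen G) {γ : ℝ≥0∞}
    (h : ∀ᶠ n in atTop, P {ω | (fun t : I => Z n t ω) ∈ G} ≤ γ) : ν I G ≤ γ := by
  have h1 := ProbabilityMeasure.le_liminf_measure_open_of_tendsto
    (hf.tendsto_marginalLaw hν hZ I) hG
  refine h1.trans (liminf_le_of_frequently_le' (Eventually.frequently ?_))
  filter_upwards [h] with n hn
  refine le_trans (le_of_eq ?_) hn
  exact Measure.map_apply (measurable_marginal (hZ n) I) hG.measurableSet

theorem FidiConverges.eventually_measure_closed_lt (hf : FidiConverges P Z ν)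
    (hν : ∀ I, IsProbabilityMeasure (ν I)) (hZ : ∀ n t, Measurable (Z n t)) {I : Finset T}
    {F : Set (I → ℝ)} (hF : IsClosed F) {γ : ℝ≥0∞} (h : ν I F < γ) :
    ∀ᶠ n in atTop, P {ω | (fun t : I => Z n t ω) ∈ F} < γ := by
  have h1 := ProbabilityMeasure.limsup_measure_closed_le_of_tendsto
    (hf.tendsto_marginalLaw hν hZ I) hF
  filter_upwards [eventually_lt_of_limsup_lt (h1.trans_lt h)] with n hn
  refine lt_of_le_of_lt (le_of_eq ?_) hn
  exact (Measure.map_apply (measurable_marginal (hZ n) I) hF.measurableSet).symm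

theorem exists_measure_norm_ge_lt {E : Type*} [SeminormedAddCommGroup E] [MeasurableSpace E]
    [OpensMeasurableSpace E] (μ : Measure E) [IsFiniteMeasure μ] {γ : ℝ≥0∞} (hγ : 0 < γ) :
    ∃ M : ℕ, μ {x | (M : ℝ) ≤ ‖x‖} < γ := by
  have hlim := tendsto_measure_iInter_atTop (μ := μ) (s := fun M : ℕ => {x : E | (M : ℝ) ≤ ‖x‖})
    (fun M => (isClosed_le continuous_const continuous_norm).measurableSet.nullMeasurableSet)
    (fun i j hij x (hx : (j : ℝ) ≤ ‖x‖) =>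
      show (i : ℝ) ≤ ‖x‖ from (Nat.cast_le.2 hij).trans hx) ⟨0, measure_ne_top _ _⟩
  have hemp : ⋂ M : ℕ, {x : E | (M : ℝ) ≤ ‖x‖} = ∅ := by
    refine Set.eq_empty_of_forall_notMem fun x hx => ?_
    obtain ⟨M, hM⟩ := exists_nat_gt ‖x‖
    exact absurd (Set.mem_iInter.1 hx M) (not_le.2 hM)
  rw [hemp, measure_empty] at hlim
  exact (hlim.eventually (gt_mem_nhds hγ)).exists

variable {I : ℕ → Finset T} {p : ℕ → T → T} {r : ℕ → ℝ}

theorem isOpen_oscillating (I : Finset T) (d : T → T → ℝ) (δ ε : ℝ) :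
    IsOpen (oscillating (fun s t : I => d s t) δ ε) := by
  have : oscillating (fun s t : I => d s t) δ ε
      = ⋃ (s : I) (t : I) (_ : d s t ≤ δ), {x | ε < |x s - x t|} := by
    ext x; simp [oscillating]
  rw [this]
  refine isOpen_iUnion fun s => isOpen_iUnion fun t => isOpen_iUnion fun _ => ?_
  exact isOpen_lt continuous_const ((continuous_apply s).sub (continuous_apply t)).abs

theorem IsChainOfNets.measure_oscillating_le (hN : IsChainOfNets P Z d I p r)
    (hf : FidiConverges P Z ν) (hν : ∀ I, IsProbabilityMeasure (ν I))
    (hZ : ∀ n t, Measurable (Z n t)) (J : Finset T) (j : ℕ) :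
    ν J (oscillating (fun s t : J => d s t) (3 * r j) ((1 / 2) ^ j)) ≤ 2⁻¹ ^ j := by
  refine hf.measure_open_le hν hZ (isOpen_oscillating J d _ _) ?_
  filter_upwards [hN.oscillation j] with n hn
  refine (measure_mono ?_).trans hn
  rintro ω ⟨s, t, hst, hlt⟩
  exact ⟨s, t, hst, hlt⟩

/-- One M must serve all J. A tail bound for the single marginal on I k is carried back to Z n;
apart from an unlikely oscillation, all values of Z n stay within 1 of those on I k; the resulting
bound then passes to the limit marginal on J. -/
theorem IsChainOfNets.exists_bound (hN : IsChainOfNets P Z d I p r)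
    (hf : FidiConverges P Z ν) (hν : ∀ I, IsProbabilityMeasure (ν I))
    (hZ : ∀ n t, Measurable (Z n t)) (k : ℕ) :
    ∃ M : ℝ, ∀ J : Finset T, ν J {x | M < ‖x‖} ≤ 2 * 2⁻¹ ^ k := by
  have := hν (I k)
  obtain ⟨M, hM⟩ := exists_measure_norm_ge_lt (ν (I k))
    (ENNReal.pow_pos (show (0 : ℝ≥0∞) < 2⁻¹ by simp) k)
  refine ⟨M + 1, fun J => hf.measure_open_le hν hZ (isOpen_lt continuous_const continuous_norm) ?_⟩
  filter_upwards [hN.oscillation k, hf.eventually_measure_closed_lt hν hZ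
    (isClosed_le continuous_const continuous_norm) hM] with n h1 h2
  refine le_trans ((measure_mono ?_).trans (measure_union_le _ _))
    ((add_le_add h1 h2.le).trans (two_mul _).ge)
  intro ω hω
  by_contra hcon
  simp only [Set.mem_union, not_or] at hcon
  obtain ⟨hc1, hc2⟩ := hcon
  have hc2' : ‖fun t : I k => Z n t ω‖ < M := not_le.1 hc2
  refine absurd (show M + 1 < ‖fun t : J => Z n t ω‖ from hω) (not_lt.2 ?_)
  refine (pi_norm_le_iff_of_nonneg (by positivity)).2 fun t => ?_
  have h3 : |Z n (p k t) ω - Z n t ω| ≤ (1 / 2) ^ k := by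
    by_contra h4
    refine hc1 ⟨p k t, t, (hN.dist_le k t).trans ?_, not_le.1 h4⟩
    linarith [hN.pos k]
  have h4 : |Z n (p k t) ω| ≤ ‖fun t : I k => Z n t ω‖ :=
    norm_le_pi_norm (fun t : I k => Z n t ω) ⟨p k t, hN.mem k t⟩
  have h5 : (1 / 2 : ℝ) ^ k ≤ 1 := pow_le_one₀ (by norm_num) (by norm_num)
  have h6 : |Z n t ω| ≤ |Z n (p k t) ω| + |Z n (p k t) ω - Z n t ω| := by
    have := abs_sub_abs_le_abs_sub (Z n t ω) (Z n (p k t) ω)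
    rw [abs_sub_comm (Z n t ω)] at this
    linarith
  rw [Real.norm_eq_abs]
  linarith

/-- The law of the step function on the `m`-th net. -/
def netLaw {p : T → T} {J : Finset T} (hp : ∀ t, p t ∈ J)
    (hν : ∀ I, IsProbabilityMeasure (ν I)) : ProbabilityMeasure (EllInfty T) :=
  ⟨(ν J).map (stepMap hp), by
    have := hν J
    exact Measure.isProbabilityMeasure_map
      (lipschitzWith_stepMap hp).continuous.measurable.aemeasurable⟩

theorem tsum_two_inv_pow_add (k : ℕ) : ∑' i : ℕ, (2⁻¹ : ℝ≥0∞) ^ (k + i) = 2 * 2⁻¹ ^ k := by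
  simp_rw [pow_add]
  rw [ENNReal.tsum_mul_left, ENNReal.tsum_geometric, ENNReal.one_sub_inv_two, inv_inv, mul_comm]

/-- Outside an exceptional event, the step function on net m is bounded by M and lies within 2^(-j)
of step functions on net j for all j ≥ k. The event has mass at most 2·2^(-k) for the bound plus the
geometric sum 2·2^(-k) for the oscillations. -/
theorem IsChainOfNets.exists_compact (hN : IsChainOfNets P Z d I p r) (hd : IsSemimetric d)
    (hf : FidiConverges P Z ν) (hν : ∀ I, IsProbabilityMeasure (ν I))
    (hZ : ∀ n t, Measurable (Z n t)) (k : ℕ) :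
    ∃ K : Set (EllInfty T), IsCompact K ∧
      ∀ m, (netLaw (hN.mem m) hν : Measure (EllInfty T)) Kᶜ ≤ 4 * 2⁻¹ ^ k := by
  obtain ⟨M, hM⟩ := hN.exists_bound hf hν hZ k
  -- All nets up to level j are included, so that the step functions with m ≤ j need no
  -- approximation.
  let C : ℕ → Set (EllInfty T) := fun j =>
    ⋃ m ∈ Finset.range (j + 1), stepMap (hN.mem m) '' Metric.closedBall 0 M
  have hC : ∀ j, IsCompact (C j) := fun j => (Finset.range (j + 1)).isCompact_biUnion fun m _ =>
    (isCompact_closedBall _ _).image (lipschitzWith_stepMap (hN.mem m)).continuous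
  have hCmem : ∀ (j m : ℕ) (x : I m → ℝ), m ≤ j → ‖x‖ ≤ M → stepMap (hN.mem m) x ∈ C j :=
    fun j m x hmj hx => Set.mem_iUnion₂.2 ⟨m, Finset.mem_range.2 (by omega), x, by simpa using hx,
      rfl⟩
  refine ⟨_, isCompact_closure_of_approx hC k, fun m => ?_⟩
  have hmeas : Measurable (stepMap (hN.mem m)) :=
    (lipschitzWith_stepMap (hN.mem m)).continuous.measurable
  refine le_trans (le_of_eq (Measure.map_apply hmeas isClosed_closure.measurableSet.compl)) ?_
  have hsub : stepMap (hN.mem m) ⁻¹' (closure {z : EllInfty T | ∀ j, k ≤ j →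
      ∃ w ∈ C j, dist z w ≤ (1 / 2 : ℝ) ^ j})ᶜ ⊆ {x | M < ‖x‖} ∪
        ⋃ i : ℕ, oscillating (fun s t : I m => d s t) (3 * r (k + i)) ((1 / 2) ^ (k + i)) := by
    intro x hx
    by_contra hcon
    simp only [Set.mem_union, Set.mem_iUnion, not_or, not_exists] at hcon
    obtain ⟨hc1, hc2⟩ := hcon
    have hxM : ‖x‖ ≤ M := not_lt.1 hc1
    refine hx (subset_closure fun j hj => ?_)
    rcases le_or_gt m j with hmj | hjm
    · exact ⟨_, hCmem j m x hmj hxM, by rw [dist_self]; positivity⟩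
    -- Net j need not be contained in net m, so the value at s is read off at p m s.
    · let y : I j → ℝ := fun s => x ⟨p m s, hN.mem m s⟩
      refine ⟨_, hCmem j j y le_rfl ?_, dist_ellInfty_le (by positivity) fun t => ?_⟩
      · exact (pi_norm_le_iff_of_nonneg ((norm_nonneg _).trans hxM)).2 fun s =>
          (norm_le_pi_norm x _).trans hxM
      · rw [stepMap_apply, stepMap_apply]
        by_contra hlt
        have hc3 := hc2 (j - k)
        rw [Nat.add_sub_cancel' hj] at hc3
        refine hc3 ⟨_, _, ?_, not_le.1 hlt⟩
        -- The path from p m t through t and p j t to p m (p j t) has length at most r m + r j + r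
        -- m, hence at most 3 r j because r is antitone.
        have h1 := hN.dist_le m t
        have h2 := hN.dist_le j t
        have h3 := hN.dist_le m (p j t)
        have h4 := hN.antitone hjm.le
        have h5 := hd.triangle (p m t) t (p m (p j t))
        have h6 := hd.triangle t (p j t) (p m (p j t))
        rw [hd.symm t (p j t), hd.symm (p j t) (p m (p j t))] at h6
        simp only
        linarith
  refine (measure_mono hsub).trans ((measure_union_le _ _).trans ?_)
  refine (add_le_add (hM _) ((measure_iUnion_le _).trans (ENNReal.tsum_le_tsum fun i =>
    hN.measure_oscillating_le hf hν hZ (I m) (k + i)))).trans (le_of_eq ?_)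
  rw [tsum_two_inv_pow_add, ← add_mul]
  norm_num

/-- On the `m`-th net, outer expectations of Lipschitz functions are close to integrals. -/
theorem IsChainOfNets.eventually_outerExpectation (hN : IsChainOfNets P Z d I p r)
    (hf : FidiConverges P Z ν) (hν : ∀ I, IsProbabilityMeasure (ν I))
    (hZ : ∀ n t, Measurable (Z n t)) (hmem : ∀ n ω, Memℓp (fun t => Z n t ω) ∞)
    (h : EllInfty T →ᵇ ℝ) {L : NNReal} (hL : LipschitzWith L h) {ε : ℝ} (hε : 0 < ε) (m : ℕ) :
    ∀ᶠ n in atTop,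
      ((∫ z, h z ∂(netLaw (hN.mem m) hν : Measure (EllInfty T))
          - ((L + 2 * ‖h‖) * (1 / 2) ^ m + ε) : ℝ) : EReal)
        ≤ outerExpectation P (fun ω => h (toEllInfty fun t => Z n t ω)) ∧
      outerExpectation P (fun ω => h (toEllInfty fun t => Z n t ω))
        ≤ ((∫ z, h z ∂(netLaw (hN.mem m) hν : Measure (EllInfty T))
          + ((L + 2 * ‖h‖) * (1 / 2) ^ m + ε) : ℝ) : EReal) := by
  have hcont : Continuous (stepMap (hN.mem m)) := (lipschitzWith_stepMap (hN.mem m)).continuous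
  have hint : ∫ z, h z ∂(netLaw (hN.mem m) hν : Measure (EllInfty T))
      = ∫ x, h (stepMap (hN.mem m) x) ∂(ν (I m)) :=
    integral_map hcont.measurable.aemeasurable h.continuous.measurable.aestronglyMeasurable
  have hlim : Tendsto (fun n => ∫ ω, h (stepMap (hN.mem m) fun t => Z n t ω) ∂P) atTop
      (𝓝 (∫ z, h z ∂(netLaw (hN.mem m) hν : Measure (EllInfty T)))) := by
    rw [hint]
    exact hf (I m) (h.compContinuous ⟨_, hcont⟩)
  filter_upwards [hN.oscillation m, hlim.eventually (gt_mem_nhds (lt_add_of_pos_right _ hε)),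
    hlim.eventually (lt_mem_nhds (sub_lt_self _ hε))] with n hosc hub hlb
  set W : Ω → ℝ := fun ω => h (stepMap (hN.mem m) fun t => Z n t ω) with hW
  set A : Set Ω := {ω | (fun t => Z n t ω) ∈ oscillating d (3 * r m) ((1 / 2) ^ m)} with hA
  -- The oscillation event involves arbitrarily many indices and may be nonmeasurable; its
  -- measurable hull has the same outer measure.
  set B := toMeasurable P A with hB
  have hBm : MeasurableSet B := measurableSet_toMeasurable P A
  have hBP : P.real B ≤ (1 / 2) ^ m := by
    rw [Measure.real, measure_toMeasurable]
    refine ENNReal.toReal_le_of_le_ofReal (by positivity) (hosc.trans (le_of_eq ?_))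
    rw [ENNReal.ofReal_pow (by norm_num), one_div, ENNReal.ofReal_inv_of_pos two_pos]
    simp
  have hWm : Measurable W := h.continuous.measurable.comp
    (hcont.measurable.comp (measurable_marginal (hZ n) _))
  have hWb : ∀ ω, |W ω| ≤ ‖h‖ := fun ω => h.norm_coe_le_norm _
  have hWi : Integrable W P := .of_bound hWm.aestronglyMeasurable ‖h‖ (Eventually.of_forall hWb)
  -- The error of replacing the path by its step function: Lipschitz continuity controls it off B,
  -- boundedness of h on B.
  set V : Ω → ℝ := fun ω => L * (1 / 2) ^ m + B.indicator (fun _ => 2 * ‖h‖) ω with hV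
  have hVm : Measurable V := measurable_const.add (measurable_const.indicator hBm)
  have hVi' : Integrable (B.indicator fun _ => 2 * ‖h‖ : Ω → ℝ) P :=
    (integrable_const _).indicator hBm
  have hVi : Integrable V P := (integrable_const _).add hVi'
  have hVint : ∫ ω, V ω ∂P ≤ (L + 2 * ‖h‖) * (1 / 2) ^ m := by
    rw [integral_add (integrable_const _) hVi', integral_indicator_const _ hBm]
    simp only [integral_const, probReal_univ, smul_eq_mul, one_mul]
    nlinarith [norm_nonneg h]
  have hdiff : ∀ ω, |h (toEllInfty fun t => Z n t ω) - W ω| ≤ V ω := by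
    intro ω
    by_cases hω : ω ∈ B
    · have h1 := h.norm_coe_le_norm (toEllInfty fun t => Z n t ω)
      have h2 := hWb ω
      have h3 : 0 ≤ (L : ℝ) * (1 / 2) ^ m := by positivity
      rw [Real.norm_eq_abs] at h1
      simp only [hV, Set.indicator_of_mem hω]
      linarith [abs_sub (h (toEllInfty fun t => Z n t ω)) (W ω)]
    · simp only [hV, Set.indicator_of_notMem hω, add_zero]
      rw [← Real.dist_eq]
      refine (hL.dist_le_mul _ _).trans (mul_le_mul_of_nonneg_left ?_ L.2)
      refine dist_ellInfty_le (by positivity) fun t => ?_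
      rw [toEllInfty_apply (hmem n ω), stepMap_apply, abs_sub_comm]
      by_contra hlt
      refine hω (subset_toMeasurable P A ⟨p m t, t, (hN.dist_le m t).trans ?_, not_le.1 hlt⟩)
      linarith [hN.pos m]
  constructor
  · refine le_trans (EReal.coe_le_coe_iff.2 ?_) (integral_le_outerExpectation (hWi.sub hVi)
      (Y := fun ω => h (toEllInfty fun t => Z n t ω)) fun ω => ?_)
    · simp only [Pi.sub_apply]
      rw [integral_sub hWi hVi]
      linarith
    · have := (abs_le.1 (hdiff ω)).1
      simp only [Pi.sub_apply]
      linarith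
  · refine (outerExpectation_le_integral (hWm.add hVm) (hWi.add hVi) fun ω => ?_).trans
      (EReal.coe_le_coe_iff.2 ?_)
    · have := (abs_le.1 (hdiff ω)).2
      simp only [Pi.add_apply]
      linarith
    · simp only [Pi.add_apply]
      rw [integral_add hWi hVi]
      linarith

/-- An asymptotically equicontinuous sequence of bounded processes on a totally bounded index set
whose marginals converge weakly converges weakly in `ℓ^∞` to a tight law. -/
theorem AsympEquicontinuous.exists_tight_limit (hA : AsympEquicontinuous P Z d)
    (hd : IsSemimetric d) (htb : ∀ r : ℝ, 0 < r → ∃ S : Finset T, ∀ t, ∃ s ∈ S, d s t < r)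
    (hZ : ∀ n t, Measurable (Z n t)) (hmem : ∀ n ω, Memℓp (fun t => Z n t ω) ∞)
    (hν : ∀ I, IsProbabilityMeasure (ν I)) (hf : FidiConverges P Z ν) :
    ∃ μ : Measure (EllInfty T), IsProbabilityMeasure μ ∧ IsTightLaw μ ∧
      (∀ I : Finset T, μ.map (fun z (t : I) => z t) = ν I) ∧
      WeaklyConverges P (fun n ω => toEllInfty (fun t => Z n t ω)) μ := by
  obtain ⟨I, p, r, hN⟩ := hA.exists_nets htb
  choose K hK hKm using hN.exists_compact hd hf hν hZ
  let u : ℕ → NNReal := fun k => 4 * 2⁻¹ ^ k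
  have hu : Tendsto u atTop (𝓝 0) := by
    have := (tendsto_pow_atTop_nhds_zero_of_lt_one (show (0 : NNReal) ≤ 2⁻¹ by positivity)
      (show (2⁻¹ : NNReal) < 1 from inv_lt_one_of_one_lt₀ one_lt_two)).const_mul 4
    simpa [u] using this
  have hucoe : ∀ k, ((u k : NNReal) : ℝ≥0∞) = 4 * 2⁻¹ ^ k := fun k => by
    simp [u, ENNReal.coe_inv, ENNReal.inv_pow]
  -- Prokhorov's theorem: these uniform tightness bounds define a compact set of laws, which
  -- contains all step laws.
  have hcomp := isCompact_setOfPred_probabilityMeasure_mass_eq_compl_isCompact_le hu hK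
    (Or.inl inferInstance)
  obtain ⟨μ, hμ, hcl⟩ := hcomp.exists_mapClusterPt (f := atTop)
    (u := fun m => netLaw (hN.mem m) hν) (tendsto_principal.2 (Eventually.of_forall fun m k => by
      rw [← ENNReal.coe_le_coe, ProbabilityMeasure.ennreal_coeFn_eq_coeFn_toMeasure, hucoe]
      exact hKm k m))
  have hW : WeaklyConverges P (fun n ω => toEllInfty (fun t => Z n t ω))
      (μ : Measure (EllInfty T)) := by
    refine weaklyConverges_of_lipschitz fun h L hL ε hε => ?_
    have hcont : Continuous fun μ' : ProbabilityMeasure (EllInfty T) =>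
        ∫ z, h z ∂(μ' : Measure (EllInfty T)) :=
      ProbabilityMeasure.continuous_integral_boundedContinuousFunction h
    have hnear : ∀ᶠ μ' : ProbabilityMeasure (EllInfty T) in 𝓝 μ, |∫ z, h z ∂(μ' : Measure (EllInfty T))
        - ∫ z, h z ∂(μ : Measure (EllInfty T))| < ε / 3 := by
      have := hcont.continuousAt (x := μ) (Metric.ball_mem_nhds _ (show 0 < ε / 3 by linarith))
      exact this
    have hpow : Tendsto (fun m : ℕ => (L + 2 * ‖h‖) * (1 / 2 : ℝ) ^ m) atTop (𝓝 0) := by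
      simpa using (tendsto_pow_atTop_nhds_zero_of_lt_one (show (0 : ℝ) ≤ 1 / 2 by norm_num)
        (by norm_num)).const_mul ((L : ℝ) + 2 * ‖h‖)
    -- A cluster point suffices: a single m is needed whose step law is near μ and whose
    -- approximation error is small.
    obtain ⟨m, hm1, hm2⟩ := ((hcl.frequently hnear).and_eventually
      (hpow.eventually (gt_mem_nhds (show 0 < ε / 3 by linarith)))).exists
    have hm3 := abs_lt.1 hm1
    filter_upwards [hN.eventually_outerExpectation hf hν hZ hmem h hL
      (show 0 < ε / 3 by linarith) m] with n hn
    exact ⟨(EReal.coe_le_coe_iff.2 (by linarith)).trans hn.1,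
      hn.2.trans (EReal.coe_le_coe_iff.2 (by linarith))⟩
  refine ⟨μ, inferInstance, fun ε hε => ?_, fun J => ?_, hW⟩
  · have hu' : Tendsto (fun k => ((u k : NNReal) : ℝ≥0∞)) atTop (𝓝 0) := by
      simpa using ENNReal.tendsto_coe.2 hu
    obtain ⟨k, hk⟩ := (hu'.eventually (gt_mem_nhds hε)).exists
    refine ⟨K k, hK k, ?_⟩
    rw [← ProbabilityMeasure.ennreal_coeFn_eq_coeFn_toMeasure]
    exact (ENNReal.coe_le_coe.2 (hμ k)).trans hk.le
  · have hcont := continuous_eval_ellInfty J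
    have := hν J
    have : IsProbabilityMeasure ((μ : Measure (EllInfty T)).map fun z (t : J) => z t) :=
      Measure.isProbabilityMeasure_map hcont.measurable.aemeasurable
    refine ext_of_forall_integral_eq_of_IsFiniteMeasure fun h => ?_
    rw [integral_map hcont.measurable.aemeasurable h.continuous.measurable.aestronglyMeasurable]
    -- Functions of finitely many coordinates are measurable along the process, so their outer
    -- expectations are integrals, and uniqueness of limits identifies the marginal on J.
    have h1 := hW (h.compContinuous ⟨_, hcont⟩)
    have h2 : Tendsto (fun n => ((∫ ω, h (fun t : J => Z n t ω) ∂P : ℝ) : EReal)) atTop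
        (𝓝 ((∫ x, h x ∂(ν J) : ℝ) : EReal)) :=
      (continuous_coe_real_ereal.tendsto _).comp (hf J h)
    have h3 : ∀ n, outerExpectation P (fun ω => (h.compContinuous ⟨_, hcont⟩)
        (toEllInfty fun t => Z n t ω)) = ((∫ ω, h (fun t : J => Z n t ω) ∂P : ℝ) : EReal) := by
      intro n
      have hm : Measurable fun ω => h (fun t : J => Z n t ω) :=
        h.continuous.measurable.comp (measurable_marginal (hZ n) _)
      rw [← outerExpectation_eq_integral hm (.of_bound hm.aestronglyMeasurable ‖h‖
        (Eventually.of_forall fun ω => h.norm_coe_le_norm _))]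
      congr 1
      funext ω
      simp [toEllInfty_apply (hmem n ω)]
    simp only [h3] at h1
    exact EReal.coe_injective (tendsto_nhds_unique h1 h2)

end

/-! Orlicz norms of sums -/

/-- (|Y| + |Y'|)/(C + C') is the convex combination of |Y|/C and |Y'|/C' with weights C/(C + C') and
C'/(C + C'). -/
theorem IsYoung.orliczNorm_add_le {Ω : Type*} [MeasurableSpace Ω] {P : Measure Ω} {ψ : ℝ → ℝ}
    (hψ : IsYoung ψ) {Y Y' : Ω → ℝ} (hY : Measurable Y) :
    orliczNorm P ψ (fun ω => Y ω + Y' ω) ≤ orliczNorm P ψ Y + orliczNorm P ψ Y' := by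
  refine ENNReal.le_iInf₂_add_iInf₂ fun C hC C' hC' => ?_
  obtain ⟨hC, hC1⟩ := hC
  obtain ⟨hC', hC1'⟩ := hC'
  rw [← ENNReal.ofReal_add hC.le hC'.le]
  refine iInf₂_le_of_le (C + C') ⟨by positivity, ?_⟩ le_rfl
  have hs : 0 < C + C' := by positivity
  have ha : 0 ≤ C / (C + C') := by positivity
  have hb : 0 ≤ C' / (C + C') := by positivity
  have hab : C / (C + C') + C' / (C + C') = 1 := by field_simp
  have hpt : ∀ ω, ENNReal.ofReal (ψ (|Y ω + Y' ω| / (C + C')))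
      ≤ ENNReal.ofReal (C / (C + C')) * ENNReal.ofReal (ψ (|Y ω| / C))
        + ENNReal.ofReal (C' / (C + C')) * ENNReal.ofReal (ψ (|Y' ω| / C')) := by
    intro ω
    have h1 : 0 ≤ |Y ω| / C := by positivity
    have h2 : 0 ≤ |Y' ω| / C' := by positivity
    rw [← ENNReal.ofReal_mul ha, ← ENNReal.ofReal_mul hb, ← ENNReal.ofReal_add
      (mul_nonneg ha (hψ.nonneg h1)) (mul_nonneg hb (hψ.nonneg h2))]
    refine ENNReal.ofReal_le_ofReal (le_trans ?_ (hψ.convex.2 (Set.mem_Ici.2 h1)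
      (Set.mem_Ici.2 h2) ha hb hab))
    refine hψ.monotone (Set.mem_Ici.2 (by positivity)) (Set.mem_Ici.2 ?_) ?_
    · simp only [smul_eq_mul]; positivity
    · simp only [smul_eq_mul]
      have : C / (C + C') * (|Y ω| / C) + C' / (C + C') * (|Y' ω| / C')
          = (|Y ω| + |Y' ω|) / (C + C') := by field_simp
      rw [this]
      exact div_le_div_of_nonneg_right (abs_add_le _ _) hs.le
  refine (lintegral_mono hpt).trans ?_
  rw [lintegral_add_left ((hψ.measurable_comp_abs hY hC.le).const_mul _),
    lintegral_const_mul _ (hψ.measurable_comp_abs hY hC.le),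
    lintegral_const_mul' _ _ ENNReal.ofReal_ne_top]
  calc _ ≤ ENNReal.ofReal (C / (C + C')) * 1 + ENNReal.ofReal (C' / (C + C')) * 1 := by gcongr
    _ = 1 := by rw [mul_one, mul_one, ← ENNReal.ofReal_add ha hb, hab, ENNReal.ofReal_one]

/-! Consequences of a uniformly small expected modulus -/

section

variable {T Ω : Type*} [MeasurableSpace Ω] {P : Measure Ω}

/-- The expected modulus of continuity is small, uniformly in `n ≥ 1`. -/
def UniformlySmallModulus (P : Measure Ω) (Z : ℕ → T → Ω → ℝ) (d : T → T → ℝ) : Prop :=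
  ∀ ε : ℝ, 0 < ε → ∃ η : ℝ, 0 < η ∧ ∀ n : ℕ, 1 ≤ n →
    AEMeasurable (modulus (Z n) d Set.univ η) P ∧
    ∫⁻ ω, modulus (Z n) d Set.univ η ω ∂P < ENNReal.ofReal ε

/-- Markov's inequality: an expected modulus below εc gives probability at most c. Admitting a
second semimetric `d'` covers both τ_s and τ. -/
theorem UniformlySmallModulus.asympEquicontinuous {Z : ℕ → T → Ω → ℝ} {d : T → T → ℝ}
    (h : UniformlySmallModulus P Z d) {d' : T → T → ℝ}
    (hd : ∀ η : ℝ, 0 < η → ∃ δ : ℝ, 0 < δ ∧ ∀ s t, d' s t ≤ δ → d s t < η) :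
    AsympEquicontinuous P Z d' := by
  intro ε hε
  refine ENNReal.tendsto_nhds_zero.2 fun γ hγ => ?_
  obtain ⟨c, -, hc0, hcγ⟩ := ENNReal.lt_iff_exists_real_btwn.1 hγ
  have hc : 0 < c := ENNReal.ofReal_pos.1 hc0
  obtain ⟨η, hη, hZ⟩ := h (ε * c) (by positivity)
  obtain ⟨δ, hδ, hδη⟩ := hd η hη
  filter_upwards [Ioc_mem_nhdsGT hδ] with δ' hδ'
  refine limsup_le_of_le (h := ?_)
  filter_upwards [eventually_ge_atTop 1] with n hn
  obtain ⟨hm, hlt⟩ := hZ n hn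
  have hsub : P {ω | ENNReal.ofReal ε < ⨆ (s : T) (t : T) (_ : d' s t ≤ δ'),
      ENNReal.ofReal |Z n s ω - Z n t ω|}
      ≤ P {ω | ENNReal.ofReal ε ≤ modulus (Z n) d Set.univ η ω} := by
    refine measure_mono fun ω hω => ?_
    have hω' : ENNReal.ofReal ε < ⨆ (s : T) (t : T) (_ : d' s t ≤ δ'),
        ENNReal.ofReal |Z n s ω - Z n t ω| := hω
    refine hω'.le.trans ?_
    exact iSup_mono fun s => iSup_mono fun t => iSup_mono' fun hst =>
      ⟨⟨Set.mem_univ s, Set.mem_univ t, hδη s t (hst.trans hδ'.2)⟩, le_rfl⟩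
  refine hsub.trans (le_trans ?_ hcγ.le)
  have h1 := (mul_meas_ge_le_lintegral₀ hm (ENNReal.ofReal ε)).trans hlt.le
  rw [ENNReal.ofReal_mul hε.le] at h1
  exact (ENNReal.mul_le_mul_iff_right (ENNReal.ofReal_pos.2 hε).ne' ENNReal.ofReal_ne_top).1 h1

/-- The infimum of the moduli at countably many scales has expectation below 1/(k + 1) for every k,
hence vanishes almost surely. -/
theorem UniformlySmallModulus.ae_uniformlyContinuous {Z : ℕ → T → Ω → ℝ} {d : T → T → ℝ}
    (h : UniformlySmallModulus P Z d) {n : ℕ} (hn : 1 ≤ n) :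
    ∀ᵐ ω ∂P, ∀ ε : ℝ, 0 < ε → ∃ δ : ℝ, 0 < δ ∧ ∀ s t, d s t < δ → |Z n s ω - Z n t ω| < ε := by
  choose η hη hηn using fun k : ℕ => h (1 / ((k : ℝ) + 1)) Nat.one_div_pos_of_nat
  have hm : AEMeasurable (fun ω => ⨅ k, modulus (Z n) d Set.univ (η k) ω) P :=
    AEMeasurable.iInf fun k => (hηn k n hn).1
  have h0 : ∫⁻ ω, ⨅ k, modulus (Z n) d Set.univ (η k) ω ∂P = 0 := by
    have hle : ∀ k : ℕ, ∫⁻ ω, ⨅ k, modulus (Z n) d Set.univ (η k) ω ∂P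
        ≤ ENNReal.ofReal (1 / ((k : ℝ) + 1)) := fun k =>
      (lintegral_mono fun ω => iInf_le _ k).trans (hηn k n hn).2.le
    have hlim := ENNReal.tendsto_ofReal (tendsto_one_div_add_atTop_nhds_zero_nat (𝕜 := ℝ))
    rw [ENNReal.ofReal_zero] at hlim
    exact nonpos_iff_eq_zero.1 (ge_of_tendsto' hlim hle)
  filter_upwards [(lintegral_eq_zero_iff' hm).1 h0] with ω hω ε hε
  have hlt : ⨅ k, modulus (Z n) d Set.univ (η k) ω < ENNReal.ofReal ε := by
    rw [hω]; exact ENNReal.ofReal_pos.2 hε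
  obtain ⟨k, hk⟩ := iInf_lt_iff.1 hlt
  refine ⟨η k, hη k, fun s t hst => ?_⟩
  refine (ENNReal.ofReal_lt_ofReal_iff hε).1 (lt_of_le_of_lt ?_ hk)
  exact le_iSup₂_of_le s t (le_iSup_of_le ⟨Set.mem_univ s, Set.mem_univ t, hst⟩ le_rfl)

theorem UniformlySmallModulus.exists_continuous_version {Z : ℕ → T → Ω → ℝ} {d : T → T → ℝ}
    (h : UniformlySmallModulus P Z d) (hZ : ∀ n t, Measurable (Z n t))
    (hmem : ∀ n ω, Memℓp (fun t => Z n t ω) ∞) {n : ℕ} (hn : 1 ≤ n) :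
    ∃ Z' : T → Ω → ℝ, (∀ t, Measurable (Z' t)) ∧ (∀ t, Z' t =ᵐ[P] Z n t) ∧
      (∀ ω, ContinuousPath d (fun t => Z' t ω)) ∧
      (∀ᵐ ω ∂P, BoundedUniformlyContinuousPath d (fun t => Z' t ω)) := by
  obtain ⟨N, hN, hNm, hN0⟩ := exists_measurable_superset_of_null
    (ae_iff.1 (h.ae_uniformlyContinuous hn))
  have hgood : ∀ ω, ω ∉ N → ∀ ε : ℝ, 0 < ε → ∃ δ : ℝ, 0 < δ ∧
      ∀ s t, d s t < δ → |Z n s ω - Z n t ω| < ε := fun ω hω => by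
    by_contra hcon
    exact hω (hN hcon)
  have hae : ∀ᵐ ω ∂P, ω ∉ N := measure_eq_zero_iff_ae_notMem.1 hN0
  -- On a measurable null set containing all bad paths the process is set to zero, so every path
  -- becomes continuous.
  refine ⟨fun t => Nᶜ.indicator (Z n t), fun t => (hZ n t).indicator hNm.compl, fun t => ?_,
    fun ω => ?_, ?_⟩
  · filter_upwards [hae] with ω hω
    exact Set.indicator_of_mem (Set.mem_compl hω) _
  · by_cases hω : ω ∈ N
    · intro s ε hε
      exact ⟨1, one_pos, fun t _ => by simp [hω, hε]⟩
    · intro s ε hε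
      obtain ⟨δ, hδ, hst⟩ := hgood ω hω ε hε
      exact ⟨δ, hδ, fun t ht => by simpa [hω] using hst s t ht⟩
  · filter_upwards [hae] with ω hω
    obtain ⟨M, hM⟩ := memℓp_infty_iff.1 (hmem n ω)
    refine ⟨⟨M, fun t => ?_⟩, fun ε hε => ?_⟩
    · simpa [hω] using hM ⟨t, rfl⟩
    · simpa [hω] using hgood ω hω ε hε

end

/-! Polynomial classes -/

theorem diameter_lt_top_of_coveringNumber_ne_top {T : Type*} {d : T → T → ℝ} (hd : IsSemimetric d)
    {ε : ℝ} (h : coveringNumber d ε ≠ ⊤) : diameter d < ⊤ := by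
  obtain ⟨S, hS, -⟩ := exists_cover_card_le h
  refine lt_of_le_of_lt (iSup₂_le fun s t => ENNReal.ofReal_le_ofReal ?_)
    (ENNReal.ofReal_lt_top (r := 2 * ε + ∑ p ∈ S ×ˢ S, d p.1 p.2))
  obtain ⟨a, ha, has⟩ := hS s
  obtain ⟨b, hb, hbt⟩ := hS t
  have h1 := hd.triangle s a t
  have h2 := hd.triangle a b t
  have h3 := hd.symm s a
  have h4 : d a b ≤ ∑ p ∈ S ×ˢ S, d p.1 p.2 :=
    Finset.single_le_sum (f := fun p : T × T => d p.1 p.2) (fun p _ => hd.nonneg _ _)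
      (Finset.mem_product.2 (⟨ha, hb⟩ : (a, b).1 ∈ S ∧ (a, b).2 ∈ S))
  linarith

theorem youngInv_le_of_rpow {ψ : ℝ → ℝ} {p : ℝ} (hp : 0 < p) (hψ : ∀ x : ℝ, 0 ≤ x → ψ x = x ^ p)
    {y : ℝ≥0∞} {b : ℝ} (hb : 0 ≤ b) (hy : y ≤ ENNReal.ofReal b) :
    youngInv ψ y ≤ ENNReal.ofReal (b ^ p⁻¹) := by
  refine iSup₂_le fun x hx => ENNReal.ofReal_le_ofReal ?_
  rw [Real.le_rpow_inv_iff_of_pos hx.1 hb hp, ← hψ x hx.1]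
  exact (ENNReal.ofReal_le_ofReal_iff hb).1 (hx.2.trans hy)

/-- Near 0 the integrand is at most a constant times ε^(-a/p), which is integrable as a < p.
Elsewhere it is bounded, on a bounded range because finite covers force a finite diameter. -/
theorem IsPolynomialClass.entropyIntegral_lt_top {T : Type*} {d : T → T → ℝ}
    (hd : IsSemimetric d) {ψ : ℝ → ℝ} (hψ : IsYoung ψ) {a p : ℝ} (ha : 0 < a) (hap : a < p)
    (hψp : ∀ x : ℝ, 0 ≤ x → ψ x = x ^ p) (h : IsPolynomialClass d a) :
    entropyIntegral ψ d < ⊤ := by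
  obtain ⟨K, hK⟩ := h
  obtain ⟨ε₀, hε₀, hN⟩ := mem_nhdsGT_iff_exists_Ioc_subset.1 hK
  have hε₀' : 0 < ε₀ := hε₀
  have hp : 0 < p := ha.trans hap
  have hN' : ∀ ε, 0 < ε → ε ≤ ε₀ →
      (coveringNumber d ε : ℝ≥0∞) ≤ ENNReal.ofReal (max K 0 * ε ^ (-a)) := fun ε h1 h2 =>
    (hN ⟨h1, h2⟩ : (coveringNumber d ε : ℝ≥0∞) ≤ ENNReal.ofReal (K * ε ^ (-a))).trans
      (ENNReal.ofReal_le_ofReal (mul_le_mul_of_nonneg_right (le_max_left _ _)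
        (Real.rpow_nonneg h1.le _)))
  have htop : (coveringNumber d ε₀ : ℝ≥0∞) < ⊤ :=
    (hN' ε₀ hε₀' le_rfl).trans_lt ENNReal.ofReal_lt_top
  have hdiam : diameter d < ⊤ := diameter_lt_top_of_coveringNumber_ne_top hd (ε := ε₀)
    (fun h => by rw [h] at htop; simp at htop)
  -- The split is at 2ε₀ because covering numbers enter at radius ε/2.
  have hsub : {ε : ℝ | 0 < ε ∧ ENNReal.ofReal ε ≤ diameter d}
      ⊆ Set.Ioc 0 (2 * ε₀) ∪ Set.Ioc (2 * ε₀) (diameter d).toReal := by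
    intro ε hε
    rcases le_or_gt ε (2 * ε₀) with h1 | h1
    · exact Or.inl ⟨hε.1, h1⟩
    · exact Or.inr ⟨h1, (ENNReal.ofReal_le_iff_le_toReal hdiam.ne).1 hε.2⟩
  refine ((lintegral_mono_set hsub).trans (lintegral_union_le _ _ _)).trans_lt
    (ENNReal.add_lt_top.2 ⟨?_, ?_⟩)
  · set c : ℝ := (max K 0 * (1 / 2) ^ (-a)) ^ p⁻¹ with hc
    have hint : IntegrableOn (fun ε : ℝ => c * ε ^ (-a * p⁻¹)) (Set.Ioc 0 (2 * ε₀)) := by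
      refine Integrable.const_mul ?_ c
      have hlt : -1 < -a * p⁻¹ := by
        rw [neg_mul, neg_lt_neg_iff, ← div_eq_mul_inv, div_lt_one hp]
        exact hap
      exact (intervalIntegrable_iff_integrableOn_Ioc_of_le (by positivity)).1
        (intervalIntegral.intervalIntegrable_rpow' hlt)
    refine lt_of_le_of_lt (setLIntegral_mono' measurableSet_Ioc fun ε hε => ?_)
      (lintegral_ofReal_ne_top hint).lt_top
    have h0 : 0 < ε := hε.1
    refine (youngInv_le_of_rpow hp hψp ?_ (hN' (ε / 2) (half_pos h0) ?_)).trans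
      (ENNReal.ofReal_le_ofReal (le_of_eq ?_))
    · positivity
    · linarith [hε.2]
    · rw [hc, show ε / 2 = 1 / 2 * ε by ring, Real.mul_rpow (by norm_num) h0.le, ← mul_assoc,
        Real.mul_rpow (by positivity) (by positivity), ← Real.rpow_mul h0.le]
  · refine lt_of_le_of_lt (setLIntegral_mono' measurableSet_Ioc
      (g := fun _ => youngInv ψ (coveringNumber d ε₀ : ℝ≥0∞)) fun ε hε => youngInv_mono ψ ?_) ?_
    · exact_mod_cast coveringNumber_anti d (show ε₀ ≤ ε / 2 by linarith [hε.1])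
    · rw [setLIntegral_const]
      exact ENNReal.mul_lt_top (hψ.youngInv_lt_top htop) (by simp)

/-! The smoothed sequential empirical process -/

theorem sqrt_le_sqrt_add_sqrt {a b c : ℝ} (ha : 0 ≤ a) (hb : 0 ≤ b) (h : c ≤ a + b) :
    √c ≤ √a + √b := by
  refine Real.sqrt_le_iff.2 ⟨by positivity, ?_⟩
  nlinarith [Real.sq_sqrt ha, Real.sq_sqrt hb, mul_nonneg (Real.sqrt_nonneg a) (Real.sqrt_nonneg b)]

section

variable {Ω 𝒳 : Type*} [MeasurableSpace Ω] {P : Measure Ω}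
  {X : ℕ → ℕ → Ω → 𝒳} {𝓐 : Set (Set ℝ)} {𝓕 : Set (𝒳 → ℝ)} {ρ : 𝓕 → 𝓕 → ℝ}

theorem isSemimetric_tauS (h𝓐 : ∀ A ∈ 𝓐, IsRegularBorel A) (hρ : IsSemimetric ρ) :
    IsSemimetric (tauS 𝓐 𝓕 ρ) where
  self q := by simp [tauS, hρ.self]
  nonneg q r := add_nonneg (Real.sqrt_nonneg _) (hρ.nonneg _ _)
  symm q r := by rw [tauS, tauS, symmDiff_comm, hρ.symm]
  triangle q r s := by
    have hfin : ∀ A : 𝓐, volume (A : Set ℝ) ≠ ⊤ := fun A =>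
      measure_ne_top_of_subset (h𝓐 A A.2).1 (by simp)
    have h1 := sqrt_le_sqrt_add_sqrt measureReal_nonneg measureReal_nonneg
      (measureReal_symmDiff_le (μ := volume) (s := (q.1 : Set ℝ)) (t := (r.1 : Set ℝ))
        (s.1 : Set ℝ) (hfin _) (hfin _))
    have h2 := hρ.triangle q.2 r.2 s.2
    simp only [tauS]
    linarith

theorem tauS_lt_of_tau_le (hρ : IsSemimetric ρ) {η : ℝ} (hη : 0 < η) :
    ∃ δ : ℝ, 0 < δ ∧ ∀ q r, tau 𝓐 𝓕 ρ q r ≤ δ → tauS 𝓐 𝓕 ρ q r < η := by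
  -- Both √λ(A ∆ B) and ρ(f, g) become at most η/4, since (η/2)²/4 = (η/4)².
  refine ⟨min ((η / 2) ^ 2 / 4) (η / 4), by positivity, fun q r h => ?_⟩
  have h0 : 0 ≤ volume.real (symmDiff (q.1 : Set ℝ) (r.1 : Set ℝ)) := measureReal_nonneg
  have h1 := hρ.nonneg q.2 r.2
  rw [tau] at h
  have h2 := h.trans (min_le_left _ _)
  have h3 := h.trans (min_le_right _ _)
  have h4 : √(volume.real (symmDiff (q.1 : Set ℝ) (r.1 : Set ℝ))) ≤ η / 4 := by
    refine Real.sqrt_le_iff.2 ⟨by positivity, ?_⟩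
    nlinarith
  rw [tauS]
  linarith

variable [MeasurableSpace 𝒳]

theorem measurable_smoothedProcess (hX : ∀ n i : ℕ, 1 ≤ i → i ≤ n → Measurable (X n i))
    (h𝓕 : ∀ f ∈ 𝓕, Measurable f) (n : ℕ) (q : 𝓐 × 𝓕) :
    Measurable (smoothedProcess P X 𝓐 𝓕 n q) := by
  refine (Finset.measurable_fun_sum _ fun i hi => ?_).const_mul _
  rw [Finset.mem_Icc] at hi
  exact (((h𝓕 _ q.2.2).comp (hX n i hi.1 hi.2)).sub_const _).const_mul _

/-- The increment is split at the intermediate index (r.1, q.2), so that only one argument changes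
at a time. -/
theorem exists_orliczNorm_sub_le {ψ : ℝ → ℝ} (hψ : IsYoung ψ) (hρ : IsSemimetric ρ)
    (hX : ∀ n i : ℕ, 1 ≤ i → i ≤ n → Measurable (X n i)) (h𝓕 : ∀ f ∈ 𝓕, Measurable f)
    (hLip_set : ∃ C₁ : ℝ, ∀ (A B : 𝓐) (n : ℕ), 1 ≤ n →
      ⨆ f : 𝓕, orliczNorm P ψ (fun ω =>
          smoothedProcess P X 𝓐 𝓕 n (A, f) ω - smoothedProcess P X 𝓐 𝓕 n (B, f) ω)
        ≤ ENNReal.ofReal (C₁ * √(volume.real (symmDiff (A : Set ℝ) (B : Set ℝ)))))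
    (hLip_fun : ∃ C₂ : ℝ, ∀ (f g : 𝓕) (n : ℕ), 1 ≤ n →
      ⨆ A : 𝓐, orliczNorm P ψ (fun ω =>
          smoothedProcess P X 𝓐 𝓕 n (A, f) ω - smoothedProcess P X 𝓐 𝓕 n (A, g) ω)
        ≤ ENNReal.ofReal (C₂ * ρ f g)) :
    ∃ K : ℝ, 0 < K ∧ ∀ n : ℕ, 1 ≤ n → ∀ q r : 𝓐 × 𝓕, orliczNorm P ψ (fun ω =>
        smoothedProcess P X 𝓐 𝓕 n q ω - smoothedProcess P X 𝓐 𝓕 n r ω)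
      ≤ ENNReal.ofReal (K * tauS 𝓐 𝓕 ρ q r) := by
  obtain ⟨C₁, h₁⟩ := hLip_set
  obtain ⟨C₂, h₂⟩ := hLip_fun
  set K := max 1 (max C₁ C₂) with hK
  refine ⟨K, lt_max_of_lt_left one_pos, fun n hn q r => ?_⟩
  have e : (fun ω => smoothedProcess P X 𝓐 𝓕 n q ω - smoothedProcess P X 𝓐 𝓕 n r ω)
      = fun ω => (smoothedProcess P X 𝓐 𝓕 n (q.1, q.2) ω
          - smoothedProcess P X 𝓐 𝓕 n (r.1, q.2) ω)
        + (smoothedProcess P X 𝓐 𝓕 n (r.1, q.2) ω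
          - smoothedProcess P X 𝓐 𝓕 n (r.1, r.2) ω) := by
    funext ω
    rw [sub_add_sub_cancel]
  have hK1 : C₁ ≤ K := (le_max_left _ _).trans (le_max_right _ _)
  have hK2 : C₂ ≤ K := (le_max_right _ _).trans (le_max_right _ _)
  have hK0 : 0 ≤ K := zero_le_one.trans (le_max_left _ _)
  rw [e, tauS, mul_add, ENNReal.ofReal_add (mul_nonneg hK0 (Real.sqrt_nonneg _))
    (mul_nonneg hK0 (hρ.nonneg _ _))]
  refine (hψ.orliczNorm_add_le ((measurable_smoothedProcess hX h𝓕 n _).sub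
    (measurable_smoothedProcess hX h𝓕 n _))).trans (add_le_add ?_ ?_)
  · refine (le_iSup (fun f : 𝓕 => orliczNorm P ψ (fun ω => smoothedProcess P X 𝓐 𝓕 n (q.1, f) ω
      - smoothedProcess P X 𝓐 𝓕 n (r.1, f) ω)) q.2).trans ((h₁ q.1 r.1 n hn).trans
        (ENNReal.ofReal_le_ofReal ?_))
    exact mul_le_mul_of_nonneg_right hK1 (Real.sqrt_nonneg _)
  · refine (le_iSup (fun A : 𝓐 => orliczNorm P ψ (fun ω => smoothedProcess P X 𝓐 𝓕 n (A, q.2) ω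
      - smoothedProcess P X 𝓐 𝓕 n (A, r.2) ω)) r.1).trans ((h₂ q.2 r.2 n hn).trans
        (ENNReal.ofReal_le_ofReal ?_))
    exact mul_le_mul_of_nonneg_right hK2 (hρ.nonneg _ _)

/-- Uniformity in n comes from the chaining bound: its η is chosen before the process and depends on
it only through K. -/
theorem uniformlySmallModulus_smoothedProcess [IsProbabilityMeasure P] (h𝓐_ne : 𝓐.Nonempty)
    (h𝓐 : ∀ A ∈ 𝓐, IsRegularBorel A) (h𝓕_ne : 𝓕.Nonempty) (hρ : IsSemimetric ρ)
    {ψ : ℝ → ℝ} (hψ : IsYoung ψ) (hX : ∀ n i : ℕ, 1 ≤ i → i ≤ n → Measurable (X n i))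
    (h𝓕 : ∀ f ∈ 𝓕, Measurable f)
    (hsep : ∀ n : ℕ, 1 ≤ n →
      IsSeparableProcess P (smoothedProcess P X 𝓐 𝓕 n) (tauS 𝓐 𝓕 ρ))
    (hLip : ∃ K : ℝ, 0 < K ∧ ∀ n : ℕ, 1 ≤ n → ∀ q r : 𝓐 × 𝓕, orliczNorm P ψ (fun ω =>
        smoothedProcess P X 𝓐 𝓕 n q ω - smoothedProcess P X 𝓐 𝓕 n r ω)
      ≤ ENNReal.ofReal (K * tauS 𝓐 𝓕 ρ q r))
    (hent : entropyIntegral ψ (tauS 𝓐 𝓕 ρ) < ⊤) :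
    UniformlySmallModulus P (smoothedProcess P X 𝓐 𝓕) (tauS 𝓐 𝓕 ρ) := by
  have : Nonempty (𝓐 × 𝓕) := ⟨⟨⟨_, h𝓐_ne.some_mem⟩, ⟨_, h𝓕_ne.some_mem⟩⟩⟩
  obtain ⟨K, hK, hKZ⟩ := hLip
  intro ε hε
  obtain ⟨η, hη, hmod⟩ := exists_lintegral_modulus_le P hψ hK (isSemimetric_tauS h𝓐 hρ) hent
    (half_pos hε)
  refine ⟨η, hη, fun n hn => ?_⟩
  obtain ⟨S, hS, hSae⟩ := hsep n hn
  have hZ := measurable_smoothedProcess (P := P) (𝓐 := 𝓐) hX h𝓕 n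
  refine ⟨⟨_, measurable_modulus hZ _ hS η, hSae η hη⟩, ?_⟩
  rw [lintegral_congr_ae (hSae η hη)]
  exact (hmod _ hZ (hKZ n hn) S hS).trans_lt
    ((ENNReal.ofReal_lt_ofReal_iff hε).2 (half_lt_self hε))

end

end SmoothedEmpirical

end

/-! ### The main theorem -/

theorem theorem3p1
    {Ω 𝒳 : Type*} [MeasurableSpace Ω] [MeasurableSpace 𝒳]
    (P : Measure Ω) [IsProbabilityMeasure P]
    -- the array, the classes of sets and functions, and the semimetric on the functions
    (X : ℕ → ℕ → Ω → 𝒳) (hX : ∀ n i : ℕ, 1 ≤ i → i ≤ n → Measurable (X n i))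
    (𝓐 : Set (Set ℝ)) (h𝓐_ne : 𝓐.Nonempty) (h𝓐 : ∀ A ∈ 𝓐, IsRegularBorel A)
    (𝓕 : Set (𝒳 → ℝ)) (h𝓕_ne : 𝓕.Nonempty) (h𝓕 : ∀ f ∈ 𝓕, Measurable f)
    (hF : ∃ F : 𝒳 → ℝ, IsEnvelope P X 𝓕 F)
    (ρ : 𝓕 → 𝓕 → ℝ) (hρ : IsSemimetric ρ)
    -- the Young function
    (ψ : ℝ → ℝ) (hψ : IsYoung ψ) (hψ_limsup : LimsupCondition ψ)
    (hψ_L1 : ∀ Y : Ω → ℝ, Measurable Y → ∫⁻ ω, ENNReal.ofReal |Y ω| ∂P ≤ orliczNorm P ψ Y)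
    -- separability
    (hsep : ∀ n : ℕ, 1 ≤ n →
      IsSeparableProcess P (smoothedProcess P X 𝓐 𝓕 n) (tauS 𝓐 𝓕 ρ))
    -- Lipschitz continuity in the set argument
    (hLip_set : ∃ C₁ : ℝ, ∀ (A B : 𝓐) (n : ℕ), 1 ≤ n →
      ⨆ f : 𝓕, orliczNorm P ψ (fun ω =>
          smoothedProcess P X 𝓐 𝓕 n (A, f) ω - smoothedProcess P X 𝓐 𝓕 n (B, f) ω)
        ≤ ENNReal.ofReal (C₁ * √(volume.real (symmDiff (A : Set ℝ) (B : Set ℝ)))))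
    -- Lipschitz continuity in the function argument
    (hLip_fun : ∃ C₂ : ℝ, ∀ (f g : 𝓕) (n : ℕ), 1 ≤ n →
      ⨆ A : 𝓐, orliczNorm P ψ (fun ω =>
          smoothedProcess P X 𝓐 𝓕 n (A, f) ω - smoothedProcess P X 𝓐 𝓕 n (A, g) ω)
        ≤ ENNReal.ofReal (C₂ * ρ f g)) :
    (entropyIntegral ψ (tauS 𝓐 𝓕 ρ) < ⊤ →
      -- the expected modulus of continuity is small, uniformly in `n`
      (∀ ε : ℝ, 0 < ε → ∃ η : ℝ, 0 < η ∧ ∀ n : ℕ, 1 ≤ n →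
        AEMeasurable (modulus (smoothedProcess P X 𝓐 𝓕 n) (tauS 𝓐 𝓕 ρ) Set.univ η) P ∧
        ∫⁻ ω, modulus (smoothedProcess P X 𝓐 𝓕 n) (tauS 𝓐 𝓕 ρ) Set.univ η ω ∂P
          < ENNReal.ofReal ε) ∧
      AsympEquicontinuous P (smoothedProcess P X 𝓐 𝓕) (tauS 𝓐 𝓕 ρ) ∧
      AsympEquicontinuous P (smoothedProcess P X 𝓐 𝓕) (tau 𝓐 𝓕 ρ) ∧
      -- convergence of the marginals implies weak convergence to a tight limit
      (∀ ν : (I : Finset (𝓐 × 𝓕)) → Measure (I → ℝ), (∀ I, IsProbabilityMeasure (ν I)) →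
        FidiConverges P (smoothedProcess P X 𝓐 𝓕) ν →
        ∃ μ : Measure (EllInfty (𝓐 × 𝓕)), IsProbabilityMeasure μ ∧ IsTightLaw μ ∧
          (∀ I : Finset (𝓐 × 𝓕), μ.map (fun z (t : I) => z t) = ν I) ∧
          WeaklyConverges P
            (fun n ω => toEllInfty (fun q => smoothedProcess P X 𝓐 𝓕 n q ω)) μ)) ∧
    -- polynomial classes
    (∀ a p : ℝ, 0 < a → max a 1 < p → (∀ x : ℝ, 0 ≤ x → ψ x = x ^ p) →
      IsPolynomialClass (tauS 𝓐 𝓕 ρ) a →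
      entropyIntegral ψ (tauS 𝓐 𝓕 ρ) < ⊤ ∧
      ∀ n : ℕ, 1 ≤ n → ∃ Z' : 𝓐 × 𝓕 → Ω → ℝ,
        (∀ q, Measurable (Z' q)) ∧
        (∀ q, Z' q =ᵐ[P] smoothedProcess P X 𝓐 𝓕 n q) ∧
        (∀ ω, ContinuousPath (tauS 𝓐 𝓕 ρ) (fun q => Z' q ω)) ∧
        (∀ᵐ ω ∂P, BoundedUniformlyContinuousPath (tauS 𝓐 𝓕 ρ) (fun q => Z' q ω))) := by
  have hne : Nonempty (𝓐 × 𝓕) := ⟨⟨⟨_, h𝓐_ne.some_mem⟩, ⟨_, h𝓕_ne.some_mem⟩⟩⟩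
  obtain ⟨F, hF⟩ := hF
  have hd := isSemimetric_tauS (𝓕 := 𝓕) h𝓐 hρ
  have hmem := smoothedProcess_mem P X 𝓐 𝓕 F hF
  have hZ := measurable_smoothedProcess (P := P) (𝓐 := 𝓐) hX h𝓕
  have hmod := uniformlySmallModulus_smoothedProcess h𝓐_ne h𝓐 h𝓕_ne hρ hψ hX h𝓕 hsep
    (exists_orliczNorm_sub_le hψ hρ hX h𝓕 hLip_set hLip_fun)
  refine ⟨fun hent => ?_, fun a p ha hp hψp hpoly => ?_⟩
  · have haec : AsympEquicontinuous P (smoothedProcess P X 𝓐 𝓕) (tauS 𝓐 𝓕 ρ) :=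
      (hmod hent).asympEquicontinuous fun η hη =>
        ⟨η / 2, half_pos hη, fun s t hst => hst.trans_lt (half_lt_self hη)⟩
    refine ⟨hmod hent, haec,
      (hmod hent).asympEquicontinuous fun η hη => tauS_lt_of_tau_le hρ hη, fun ν hν hf =>
      haec.exists_tight_limit hd (fun r hr => ?_) hZ hmem hν hf⟩
    obtain ⟨S, hS, -⟩ := exists_cover_card_le (coveringNumber_ne_top_of_entropy hψ hent hr)
    exact ⟨S, hS⟩
  · have hent := hpoly.entropyIntegral_lt_top hd hψ ha ((le_max_left _ _).trans_lt hp) hψp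
    exact ⟨hent, fun n hn => (hmod hent).exists_continuous_version hZ hmem hn⟩
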